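/- **Proposition (asymptotic independence of multioverlaps on the perturbation).** *Model.* For each $N\ge 1$ let $J$ be a random disorder and let $\mathcal H_N(\cdot\mid J)$ be a random function on $\Sigma_N=[-1,1]^N$ that, for almost every $J$, is twice differentiable with negative semi-definite Hessian at every point of $\Sigma_N$ (derivatives being taken within $\Sigma_N$). Assume that $\mathcal H_N$ is exchangeable in the spins: for every permutation $P$ of $\{1,\dots,N\}$ the random functions $\sigma\mapsto\mathcal H_N(\sigma_{P(1)},\dots,\sigma_{P(N)}\mid J)$ and $\sigma\mapsto\mathcal H_N(\sigma\mid J)$ on $\Sigma_N$ have the same law. Let $s_N\ge 0$ satisfy $s_N\to\infty$ and $s_N/N\to 0$, and put $\varepsilon_N=(s_N/N)^{1/3}$. *Regularised and perturbed models.* Let $\mathcal I$ be the countable set of finite tuples $I=(a_0,\dots,a_{m-1})=(2^{-i_0},\dots,2^{-i_{m-1}})$ with $m\ge1$ and integers $i_p\ge p$. Write $\iota(I)=\sum_p i_p$ and $$P_I(x)=2^{-\iota(I)-2m}\sum_{p=0}^{m-1}a_p(x+1)^p .$$ Let $\pi=(\pi_I)_{I\in\mathcal I}$ be i.i.d. Poisson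 variables of mean $s_N$ and $U=(U^I_j)_{I\in\mathcal I,\,j\ge1}$ i.i.d. uniform variables on $\{1,\dots,N\}$, with $J,\pi,U$ independent. For $\lambda\in[1/2,1]^{\mathcal I}$ set $$\mathcal H'_N(\sigma)=\mathcal H_N(\sigma\mid J)-\frac{\varepsilon_N}{2}\|\sigma\|^2-\sum_{I\in\mathcal I}\lambda_I\sum_{j=1}^{\pi_I}P_I(\sigma_{U^I_j}).$$ The last sum converges almost surely, for all $\sigma\in\Sigma_N$ simultaneously. Let $\langle\cdot\rangle$ denote the mean over independent replicas $\sigma^1,\sigma^2,\dots$ drawn from the probability measure on $\Sigma_N$ with density proportional to $e^{\mathcal H'_N}$, and $\langle\cdot\rangle_0$ the analogous mean for the Hamiltonian $\mathcal H_N(\sigma\mid J)-\frac{\varepsilon_N}{2}\|\sigma\|^2$. Let $F'_N=\ln\int_{\Sigma_N}e^{\mathcal H'_N(\sigma)}d\sigma$ and $$v'_N=\sup_{\lambda\in[1/2,1]^{\mathcal I}}\mathbb E\big[(F'_N-\mathbb E_JF'_N)^2\big],$$ where $\mathbb E$ is the expectation over $(J,\pi,U)$ and $\mathbb E_J$ that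 over $J$ only, with $\pi,U$ fixed ($v'_N=\infty$ if some $F'_N$ is not square integrable). Assume that $(v'_N)^{1/2}/s_N\to0$. *Claim.* For every $n\ge1$ and $k=(k_1,\dots,k_n)\in\mathbb N^n$ there is a constant $C(k)>0$, depending only on $k$, such that for every model and every sequence $(s_N)$ as above, the multioverlap $R^{(k)}=\frac1N\sum_{i=1}^N\prod_{l=1}^n(\sigma_i^l)^{k_l}$ satisfies $$\mathbb E\Big|\langle R^{(k)}\rangle-\langle R^{(k)}\rangle_0\Big|\le C(k)\Big(\frac{s_N}{N}\Big)^{1/6}\,(1+o_N(1)),$$ for all $N\ge1$ and all $\lambda\in[1/2,1]^{\mathcal I}$, where the $o_N(1)$ term may be chosen independently of $\lambda$, and the random variable inside the expectation is integrable. -/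

import Mathlib

open MeasureTheory ProbabilityTheory Filter Topology
open scoped NNReal ENNReal

noncomputable section

namespace LogConcaveGibbs

/-- The spin configuration space `Σ_N = [-1,1]^N`. -/
def cube (N : ℕ) : Set (Fin N → ℝ) := Set.Icc (fun _ => -1) (fun _ => 1)

/-- `H` is twice differentiable on `[-1,1]^N` (one-sidedly at the boundary) and its Hessian is
negative semi-definite at every point of `[-1,1]^N`. -/
def HasNegSemidefHessian {N : ℕ} (H : (Fin N → ℝ) → ℝ) : Prop :=
  DifferentiableOn ℝ H (cube N) ∧
  DifferentiableOn ℝ (fderivWithin ℝ H (cube N)) (cube N) ∧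
  ∀ σ ∈ cube N, ∀ v : Fin N → ℝ,
    fderivWithin ℝ (fderivWithin ℝ H (cube N)) (cube N) σ v v ≤ 0

/-- Spin exchangeability of the random Hamiltonian: for every permutation `P`, the random functions
`σ ↦ H(σ_{P(1)}, …, σ_{P(N)} | J)` and `σ ↦ H(σ | J)` on `[-1,1]^N` have the same law. -/
def SpinExchangeable {𝒥 : Type*} [MeasurableSpace 𝒥] (μ : Measure 𝒥) {N : ℕ}
    (H : 𝒥 → (Fin N → ℝ) → ℝ) : Prop :=
  ∀ P : Equiv.Perm (Fin N),
    IdentDistrib (fun (J : 𝒥) (σ : cube N) => H J (fun i => σ.1 (P i)))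
      (fun (J : 𝒥) (σ : cube N) => H J σ.1) μ μ

/-- The partition function `∫_{[-1,1]^N} exp H(σ) dσ`. -/
def partitionFunction {N : ℕ} (H : (Fin N → ℝ) → ℝ) : ℝ :=
  ∫ σ in cube N, Real.exp (H σ)

/-- The free entropy of the Hamiltonian `H`. -/
def freeEntropy {N : ℕ} (H : (Fin N → ℝ) → ℝ) : ℝ := Real.log (partitionFunction H)

/-- The Gibbs measure on `[-1,1]^N`, with Lebesgue density proportional to `exp H`. -/
def gibbs {N : ℕ} (H : (Fin N → ℝ) → ℝ) : Measure (Fin N → ℝ) :=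
  (volume.restrict (cube N)).tilted H

/-- The thermal mean of a function `A` of `n` replicas, i.e. of `n` independent samples
`σ 0, …, σ (n - 1)` of the Gibbs measure of `H`. -/
def thermalMean {N n : ℕ} (H : (Fin N → ℝ) → ℝ) (A : (Fin n → Fin N → ℝ) → ℝ) : ℝ :=
  ∫ σ, A σ ∂(Measure.pi fun _ : Fin n => gibbs H)

/-- The multioverlap `R^{(k)} = N⁻¹ ∑_i ∏_l (σ_i^l)^{k_l}`. -/
def multioverlap {N n : ℕ} (k : Fin n → ℕ) (σ : Fin n → Fin N → ℝ) : ℝ :=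
  (N : ℝ)⁻¹ * ∑ i, ∏ l, σ l i ^ k l

/-- The Gaussian regularisation `-(ε / 2) ‖σ‖²` (Euclidean norm). -/
def gaussHamiltonian {N : ℕ} (ε : ℝ) (σ : Fin N → ℝ) : ℝ :=
  -(ε / 2) * ∑ i, σ i ^ 2

/-- The countable set of tuples `I = (2^{-i_0}, …, 2^{-i_{m-1}})`, `m ≥ 1`, `i_p ≥ p`; such a tuple
is encoded by its exponents `(i_0, …, i_{m-1})`. -/
abbrev PertIndex : Type := Σ m : ℕ+, {e : Fin m → ℕ // ∀ p : Fin m, (p : ℕ) ≤ e p}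

/-- `P_I(x) = 2^{-ι(I) - 2m} ∑_{p < m} a_p (x + 1)^p` with `a_p = 2^{-i_p}`, `ι(I) = ∑_p i_p`. -/
def pertPoly (I : PertIndex) (x : ℝ) : ℝ :=
  (1 / 2 : ℝ) ^ ((∑ p, I.2.1 p) + 2 * (I.1 : ℕ)) *
    ∑ p : Fin I.1, (1 / 2 : ℝ) ^ I.2.1 p * (x + 1) ^ (p : ℕ)

/-- The values of the Poisson variables `π = (π_I)` and of the spin indices `U = (U_j^I)`, where `j`
is counted from `0`. -/
abbrev PertDisorder (N : ℕ) : Type := (PertIndex → ℕ) × (PertIndex × ℕ → Fin N)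

/-- The law of `(π, U)`: all variables are independent, the `π_I` are Poisson of mean `s` and the
`U_j^I` are uniform on the `N` spin indices. -/
def pertLaw (N : ℕ) [NeZero N] (s : ℝ≥0) : Measure (PertDisorder N) :=
  (Measure.infinitePi fun _ : PertIndex => poissonMeasure s).prod
    (Measure.infinitePi fun _ : PertIndex × ℕ => (PMF.uniformOfFintype (Fin N)).toMeasure)

/-- The Poisson perturbation at full strength, `-∑_I λ_I ∑_{j ≤ π_I} P_I(σ_{U_j^I})`. -/
def poissonHamiltonian {N : ℕ} (lam : PertIndex → ℝ) (ω : PertDisorder N) (σ : Fin N → ℝ) : ℝ :=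
  -∑' I : PertIndex, lam I * ∑ j ∈ Finset.range (ω.1 I), pertPoly I (σ (ω.2 (I, j)))

/-- The Hamiltonian `H + H^gauss`. -/
def regularisedHamiltonian {N : ℕ} (H : (Fin N → ℝ) → ℝ) (ε : ℝ) (σ : Fin N → ℝ) : ℝ :=
  H σ + gaussHamiltonian ε σ

/-- The perturbed Hamiltonian `H' = H + H^gauss + H^poiss`. -/
def perturbedHamiltonian {N : ℕ} (H : (Fin N → ℝ) → ℝ) (ε : ℝ) (lam : PertIndex → ℝ)
    (ω : PertDisorder N) (σ : Fin N → ℝ) : ℝ :=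
  H σ + gaussHamiltonian ε σ + poissonHamiltonian lam ω σ

/-- The set `[1/2, 1]^𝓘` of perturbation parameters. -/
def lambdaSet : Set (PertIndex → ℝ) := {lam | ∀ I, lam I ∈ Set.Icc (1 / 2 : ℝ) 1}

/-- `v'_N = sup_λ 𝔼[(F' - 𝔼_J F')²]`, where `F'` is the free entropy of the perturbed Hamiltonian,
`𝔼` is over `(J, π, U)`, and `𝔼_J` is over `J` only (with `π`, `U` fixed). It is `∞` when `F'` is
not square integrable. -/
def perturbedVariance {𝒥 : Type*} [MeasurableSpace 𝒥] (μ : Measure 𝒥) {N : ℕ} [NeZero N]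
    (H : 𝒥 → (Fin N → ℝ) → ℝ) (ε : ℝ) (s : ℝ≥0) : ℝ≥0∞ :=
  ⨆ lam ∈ lambdaSet, ∫⁻ ω : 𝒥 × PertDisorder N,
    ENNReal.ofReal ((freeEntropy (perturbedHamiltonian (H ω.1) ε lam ω.2)
      - ∫ J, freeEntropy (perturbedHamiltonian (H J) ε lam ω.2) ∂μ) ^ 2) ∂(μ.prod (pertLaw N s))

/-- The regularisation strength `ε_N = (s_N / N)^{1/3}`. -/
def epsilon (s : ℕ+ → ℝ≥0) (N : ℕ+) : ℝ := ((s N : ℝ) / (N : ℕ)) ^ (1 / 3 : ℝ)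

end LogConcaveGibbs

end

open LogConcaveGibbs

open LogConcaveGibbs

/-! Fix the disorder. The Gaussian term makes the Hamiltonian `G` without the Poisson sum uniformly
concave with modulus `ε`, so its Gibbs measure is sub-Gaussian for Euclidean Lipschitz functions;
this is Maurey's argument from the Prékopa–Leindler inequality
(`integral_exp_mul_integral_exp_neg_le`, `integral_exp_gibbs_le`). By duality with relative entropy,
adding a `B`-Lipschitz `V` to `G` moves the mean of an `L`-Lipschitz observable by at most `4LB/ε`
(`integral_gibbs_add_sub_integral_gibbs_le`); only the Lipschitz constant of `V` enters. Replicas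
are independent, so the mean multioverlap is a site average of products of one-spin moments, and
signed site averages of `σ_i^k` are Lipschitz with constant of order `N^{-1/2}`. Hence the mean
multioverlap changes by at most a constant times `B/(ε√N)`.

It remains to see that `B` is of order `√s`, not `s`. By Cauchy–Schwarz over sites
(`sum_abs_comp_le`), the Lipschitz constant of the contribution of `I` is at most its weight times
the square root of the number of pairs of Poisson points on a common site. That number has mean `s +
s²/N` (`lintegral_collisions`), and the weights are summable (`tsum_pertWeight_ne_top`). With `ε =
(s/N)^{1/3}` the bound becomes a constant times `(s/N)^{1/6} √(1 + s/N)`, whose last factor is `1 +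
o(1)` and does not involve `λ`. -/

namespace LogConcaveGibbs

/-! ### The Prékopa–Leindler inequality -/

/-- One-dimensional Brunn–Minkowski inequality for compact sets, at the midpoint. -/
theorem volume_add_le_of_midpoint_mem_of_isCompact {A B C : Set ℝ} (hA : IsCompact A)
    (hB : IsCompact B) (hA0 : A.Nonempty) (hB0 : B.Nonempty)
    (hC : ∀ x ∈ A, ∀ y ∈ B, (x + y) / 2 ∈ C) :
    volume A + volume B ≤ 2 * volume C := by
  obtain ⟨a, ha, hamax⟩ := hA.exists_isGreatest hA0
  obtain ⟨b, hb, hbmin⟩ := hB.exists_isLeast hB0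
  have hvol : ∀ (S : Set ℝ) (c : ℝ),
      volume ((fun x : ℝ => (1 / 2 : ℝ) * x + c) '' S) = ENNReal.ofReal (1 / 2) * volume S := by
    intro S c
    have : (fun x : ℝ => (1 / 2 : ℝ) * x + c) '' S
        = (fun x => x + c) '' ((fun x : ℝ => (1 / 2 : ℝ) • x) '' S) := by
      rw [Set.image_image]; rfl
    rw [this, Set.image_add_right, measure_preimage_add_right, Set.image_smul,
      Measure.addHaar_smul]
    simp
  -- With `a = max A` and `b = min B`, the midpoints of `A` with `b` lie to the left of `(a + b) /
  -- 2` and those of `a` with `B` to the right, so the two half-size copies meet in at most one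
  -- point.
  set A' := (fun x : ℝ => (1 / 2 : ℝ) * x + b / 2) '' A with hA'
  set B' := (fun x : ℝ => (1 / 2 : ℝ) * x + a / 2) '' B with hB'
  have hsub : A' ∪ B' ⊆ C := by
    rintro z (⟨x, hx, rfl⟩ | ⟨x, hx, rfl⟩)
    · have := hC x hx b hb
      convert this using 1; ring
    · have := hC a ha x hx
      convert this using 1; ring
  have hmB : MeasurableSet B' := (hB.image (by fun_prop)).measurableSet
  have hdisj : AEDisjoint volume A' B' := by
    refine measure_mono_null (t := {(a + b) / 2}) ?_ (by simp)
    rintro z ⟨⟨x, hx, rfl⟩, ⟨y, hy, hxy⟩⟩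
    have h1 := hamax hx
    have h2 := hbmin hy
    simp only [Set.mem_singleton_iff] at *
    linarith
  have := measure_mono hsub (μ := volume)
  rw [measure_union₀ hmB.nullMeasurableSet hdisj, hA', hB', hvol, hvol, ← mul_add] at this
  calc volume A + volume B = 2 * (ENNReal.ofReal (1 / 2) * (volume A + volume B)) := by
        rw [← mul_assoc]
        rw [show (2 : ℝ≥0∞) * ENNReal.ofReal (1 / 2) = 1 by
          rw [show (2 : ℝ≥0∞) = ENNReal.ofReal 2 by simp, ← ENNReal.ofReal_mul (by norm_num)]
          simp]
        rw [one_mul]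
    _ ≤ _ := by gcongr

/-- One-dimensional Brunn–Minkowski inequality for measurable sets, at the midpoint. -/
theorem volume_add_le_of_midpoint_mem {A B C : Set ℝ} (hA : MeasurableSet A)
    (hB : MeasurableSet B) (hA0 : A.Nonempty) (hB0 : B.Nonempty)
    (hC : ∀ x ∈ A, ∀ y ∈ B, (x + y) / 2 ∈ C) :
    volume A + volume B ≤ 2 * volume C := by
  obtain ⟨a, ha⟩ := hA0
  obtain ⟨b, hb⟩ := hB0
  rw [hA.measure_eq_iSup_isCompact, hB.measure_eq_iSup_isCompact]
  simp only [iSup_and']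
  refine ENNReal.biSup_add_biSup_le' ⟨∅, Set.empty_subset _, isCompact_empty⟩
    ⟨∅, Set.empty_subset _, isCompact_empty⟩ fun K hK L hL => ?_
  -- The compact subsets given by inner regularity may be empty; inserting a fixed point of each set
  -- repairs this.
  refine (add_le_add (measure_mono (Set.subset_insert a K))
    (measure_mono (Set.subset_insert b L))).trans
    (volume_add_le_of_midpoint_mem_of_isCompact (hK.2.insert a) (hL.2.insert b)
      (Set.insert_nonempty _ _) (Set.insert_nonempty _ _) fun x hx y hy => hC x ?_ y ?_)
  · exact Set.insert_subset ha hK.1 hx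
  · exact Set.insert_subset hb hL.1 hy

/-- Prékopa–Leindler on the line for functions with supremum `1`. -/
theorem lintegral_add_le_of_mul_le_sq {u v h : ℝ → ℝ} (hu : Measurable u) (hv : Measurable v)
    (hh : Measurable h) (hu0 : ∀ x, 0 ≤ u x) (hv0 : ∀ x, 0 ≤ v x) (hh0 : ∀ x, 0 ≤ h x)
    (hu1 : ∀ x, u x ≤ 1) (hv1 : ∀ x, v x ≤ 1)
    (hus : ∀ t < 1, ∃ x, t < u x) (hvs : ∀ t < 1, ∃ x, t < v x)
    (H : ∀ x y, u x * v y ≤ h ((x + y) / 2) ^ 2) :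
    (∫⁻ x, ENNReal.ofReal (u x)) + ∫⁻ x, ENNReal.ofReal (v x)
      ≤ 2 * ∫⁻ x, ENNReal.ofReal (h x) := by
  rw [lintegral_eq_lintegral_meas_lt _ (.of_forall hu0) hu.aemeasurable,
    lintegral_eq_lintegral_meas_lt _ (.of_forall hv0) hv.aemeasurable,
    lintegral_eq_lintegral_meas_lt _ (.of_forall hh0) hh.aemeasurable]
  have hanti : ∀ f : ℝ → ℝ, Antitone fun t => volume {x | t < f x} := fun f s t hst =>
    measure_mono fun x (hx : t < f x) => hst.trans_lt hx
  rw [← lintegral_add_left (hanti u).measurable, ← lintegral_const_mul _ (hanti h).measurable]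
  refine setLIntegral_mono ((hanti h).measurable.const_mul _) fun t (ht : 0 < t) => ?_
  -- Layer cake: below level `1` both superlevel sets are nonempty, because both suprema are `1`,
  -- and Brunn–Minkowski applies; from level `1` on both are empty.
  rcases lt_or_ge t 1 with ht1 | ht1
  · refine volume_add_le_of_midpoint_mem (measurableSet_lt measurable_const hu)
      (measurableSet_lt measurable_const hv) (hus t ht1) (hvs t ht1) fun x hx y hy => ?_
    have hx : t < u x := hx
    have hy : t < v y := hy
    show t < h _
    refine lt_of_pow_lt_pow_left₀ 2 (hh0 _) (lt_of_lt_of_le ?_ (H x y))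
    nlinarith
  · have : ∀ f : ℝ → ℝ, (∀ x, f x ≤ 1) → volume {x | t < f x} = 0 := by
      intro f hf
      convert measure_empty (μ := (volume : Measure ℝ))
      ext x
      simp only [Set.mem_ofPred_eq, Set.mem_empty_iff_false, iff_false, not_lt]
      exact (hf x).trans ht1
    simp [this u hu1, this v hv1]

/-- AM–GM. It passes from the additive inequality, tied to suprema equal to `1`, to the
multiplicative one, which survives rescaling. -/
theorem ennreal_mul_le_sq_of_add_le {p q r : ℝ≥0∞} (h : p + q ≤ 2 * r) : p * q ≤ r ^ 2 := by
  rcases eq_or_ne r ⊤ with rfl | hr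
  · simp
  lift r to ℝ≥0 using hr
  have hp : p ≠ ⊤ := by rintro rfl; simp at h; exact absurd h (by finiteness)
  have hq : q ≠ ⊤ := by rintro rfl; simp at h; exact absurd h (by finiteness)
  lift p to ℝ≥0 using hp
  lift q to ℝ≥0 using hq
  norm_cast at *
  have h : (p : ℝ) + q ≤ 2 * r := by exact_mod_cast h
  have : (p : ℝ) * q ≤ r ^ 2 := by nlinarith [sq_nonneg ((p : ℝ) - q), p.2, q.2, r.2]
  exact_mod_cast this

/-- The **Prékopa–Leindler inequality** on the line, at the midpoint. -/
theorem lintegral_mul_le_sq_of_mul_le_sq {u v h : ℝ → ℝ} (hu : Measurable u) (hv : Measurable v)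
    (hh : Measurable h) (hu0 : ∀ x, 0 ≤ u x) (hv0 : ∀ x, 0 ≤ v x) (hh0 : ∀ x, 0 ≤ h x)
    {M : ℝ} (huM : ∀ x, u x ≤ M) (hvM : ∀ x, v x ≤ M)
    (H : ∀ x y, u x * v y ≤ h ((x + y) / 2) ^ 2) :
    (∫⁻ x, ENNReal.ofReal (u x)) * ∫⁻ x, ENNReal.ofReal (v x)
      ≤ (∫⁻ x, ENNReal.ofReal (h x)) ^ 2 := by
  have bu : BddAbove (Set.range u) := ⟨M, by rintro _ ⟨x, rfl⟩; exact huM x⟩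
  have bv : BddAbove (Set.range v) := ⟨M, by rintro _ ⟨x, rfl⟩; exact hvM x⟩
  set a := ⨆ x, u x with ha
  set b := ⨆ x, v x with hb
  have hua : ∀ x, u x ≤ a := le_ciSup bu
  have hvb : ∀ x, v x ≤ b := le_ciSup bv
  rcases ((hu0 0).trans (hua 0)).eq_or_lt with ha0 | ha0
  · have : ∀ x, u x = 0 := fun x => le_antisymm (ha0 ▸ hua x) (hu0 x)
    simp [this]
  rcases ((hv0 0).trans (hvb 0)).eq_or_lt with hb0 | hb0
  · have : ∀ x, v x = 0 := fun x => le_antisymm (hb0 ▸ hvb x) (hv0 x)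
    simp [this]
  -- Dividing `u` and `v` by their suprema and `h` by the geometric mean of these preserves the
  -- hypothesis and normalises the suprema to `1`.
  set c := Real.sqrt (a * b) with hc
  have hc0 : 0 < c := Real.sqrt_pos.2 (mul_pos ha0 hb0)
  have hc2 : c ^ 2 = a * b := Real.sq_sqrt (by positivity)
  have key := lintegral_add_le_of_mul_le_sq (u := fun x => a⁻¹ * u x) (v := fun x => b⁻¹ * v x)
    (h := fun x => c⁻¹ * h x) (by fun_prop) (by fun_prop) (by fun_prop)
    (fun x => mul_nonneg (by positivity) (hu0 x)) (fun x => mul_nonneg (by positivity) (hv0 x))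
    (fun x => mul_nonneg (by positivity) (hh0 x))
    (fun x => by rw [inv_mul_le_iff₀ ha0]; simpa using hua x)
    (fun x => by rw [inv_mul_le_iff₀ hb0]; simpa using hvb x)
    (fun t ht => by
      obtain ⟨x, hx⟩ := exists_lt_of_lt_ciSup (show t * a < ⨆ x, u x by rw [← ha]; nlinarith)
      exact ⟨x, by rw [lt_inv_mul_iff₀ ha0]; linarith⟩)
    (fun t ht => by
      obtain ⟨x, hx⟩ := exists_lt_of_lt_ciSup (show t * b < ⨆ x, v x by rw [← hb]; nlinarith)
      exact ⟨x, by rw [lt_inv_mul_iff₀ hb0]; linarith⟩)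
    (fun x y => by
      rw [mul_pow, inv_pow, hc2, mul_inv]
      calc a⁻¹ * u x * (b⁻¹ * v y) = a⁻¹ * b⁻¹ * (u x * v y) := by ring
        _ ≤ _ := mul_le_mul_of_nonneg_left (H x y) (by positivity))
  have key := ennreal_mul_le_sq_of_add_le key
  have hmul : ∀ (r : ℝ) (f : ℝ → ℝ), 0 < r → Measurable f →
      ∫⁻ x, ENNReal.ofReal (r⁻¹ * f x) = ENNReal.ofReal r⁻¹ * ∫⁻ x, ENNReal.ofReal (f x) := by
    intro r f hr hf
    rw [← lintegral_const_mul _ (by fun_prop)]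
    simp_rw [ENNReal.ofReal_mul (inv_nonneg.2 hr.le)]
  rw [hmul a u ha0 hu, hmul b v hb0 hv, hmul c h hc0 hh, mul_pow, mul_mul_mul_comm,
    ← ENNReal.ofReal_mul (by positivity), ← ENNReal.ofReal_pow (by positivity), inv_pow, hc2,
    mul_inv] at key
  exact (ENNReal.mul_le_mul_iff_right (by simp; positivity) (by simp)).1 key

/-- Bounded nonnegative measurable functions that vanish outside `[-1,1]^n`. -/
structure IsCubeDensity {n : ℕ} (f : (Fin n → ℝ) → ℝ) : Prop where
  measurable : Measurable f
  nonneg : ∀ x, 0 ≤ f x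
  bdd : ∃ M, ∀ x, f x ≤ M
  support : ∀ x, x ∉ cube n → f x = 0

theorem measurableSet_cube (n : ℕ) : MeasurableSet (cube n) := measurableSet_Icc

theorem isCompact_cube (n : ℕ) : IsCompact (cube n) := isCompact_Icc

theorem mem_cube_iff {n : ℕ} {x : Fin n → ℝ} : x ∈ cube n ↔ ∀ i, x i ∈ Set.Icc (-1 : ℝ) 1 := by
  simp only [cube, Set.mem_Icc, Pi.le_def]
  exact forall_and.symm

theorem cons_mem_cube_iff {n : ℕ} {t : ℝ} {x : Fin n → ℝ} :
    (Fin.cons t x : Fin (n + 1) → ℝ) ∈ cube (n + 1) ↔ t ∈ Set.Icc (-1 : ℝ) 1 ∧ x ∈ cube n := by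
  simp only [mem_cube_iff, Fin.forall_fin_succ, Fin.cons_zero, Fin.cons_succ]

namespace IsCubeDensity

variable {n : ℕ}

theorem integrable {f : (Fin n → ℝ) → ℝ} (hf : IsCubeDensity f) : Integrable f := by
  obtain ⟨M, hM⟩ := hf.bdd
  have h : IntegrableOn f (cube n) :=
    IntegrableOn.of_bound (isCompact_cube n).measure_lt_top
      hf.measurable.aestronglyMeasurable M
      (.of_forall fun x => by rw [Real.norm_of_nonneg (hf.nonneg x)]; exact hM x)
  exact (integrableOn_iff_integrable_of_support_subset fun x hx => by
    by_contra hxc; exact hx (hf.support x hxc)).1 h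

theorem section_cons {f : (Fin (n + 1) → ℝ) → ℝ} (hf : IsCubeDensity f) (t : ℝ) :
    IsCubeDensity fun x : Fin n → ℝ => f (Fin.cons t x) where
  measurable := hf.measurable.comp (by fun_prop)
  nonneg x := hf.nonneg _
  bdd := hf.bdd.imp fun M hM x => hM _
  support x hx := hf.support _ fun h => hx (cons_mem_cube_iff.1 h).2

theorem exists_integral_section_le {f : (Fin (n + 1) → ℝ) → ℝ} (hf : IsCubeDensity f) :
    ∃ M, ∀ t, ∫ x : Fin n → ℝ, f (Fin.cons t x) ≤ M := by
  obtain ⟨M, hM⟩ := hf.bdd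
  refine ⟨M * volume.real (cube n), fun t => ?_⟩
  rw [← setIntegral_eq_integral_of_forall_compl_eq_zero (s := cube n)
    (fun x hx => (hf.section_cons t).support x hx)]
  refine (setIntegral_mono_on (hf.section_cons t).integrable.integrableOn
    (integrableOn_const (isCompact_cube n).measure_lt_top.ne) (measurableSet_cube n)
    fun x _ => hM _).trans ?_
  simp [mul_comm]

theorem measurable_integral_section {f : (Fin (n + 1) → ℝ) → ℝ} (hf : IsCubeDensity f) :
    Measurable fun t => ∫ x : Fin n → ℝ, f (Fin.cons t x) := by
  have : Measurable fun p : ℝ × (Fin n → ℝ) => f (Fin.cons p.1 p.2) :=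
    hf.measurable.comp (by fun_prop)
  exact (this.stronglyMeasurable.integral_prod_right).measurable

theorem integrable_integral_section {f : (Fin (n + 1) → ℝ) → ℝ} (hf : IsCubeDensity f) :
    Integrable fun t => ∫ x : Fin n → ℝ, f (Fin.cons t x) := by
  obtain ⟨M, hM⟩ := hf.exists_integral_section_le
  have h : IntegrableOn (fun t => ∫ x : Fin n → ℝ, f (Fin.cons t x)) (Set.Icc (-1) 1) :=
    IntegrableOn.of_bound measure_Icc_lt_top hf.measurable_integral_section.aestronglyMeasurable M
      (.of_forall fun t => by
        rw [Real.norm_of_nonneg (integral_nonneg fun x => hf.nonneg _)]; exact hM t)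
  refine (integrableOn_iff_integrable_of_support_subset fun t ht => ?_).1 h
  by_contra htc
  refine ht ?_
  have : ∀ x : Fin n → ℝ, f (Fin.cons t x) = 0 := fun x =>
    hf.support _ fun h => htc (cons_mem_cube_iff.1 h).1
  simp [this]

theorem integral_eq_integral_section {f : (Fin (n + 1) → ℝ) → ℝ} (hf : IsCubeDensity f) :
    ∫ x, f x = ∫ t, ∫ x : Fin n → ℝ, f (Fin.cons t x) := by
  have h := (volume_preserving_piFinSuccAbove (fun _ : Fin (n + 1) => ℝ) 0).symm
  rw [← h.integral_comp' (g := f), Measure.volume_eq_prod, integral_prod]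
  · simp [MeasurableEquiv.piFinSuccAbove, Fin.consEquiv]
  · exact (h.integrable_comp_emb (MeasurableEquiv.measurableEmbedding _)).2 hf.integrable

end IsCubeDensity

/-- The **Prékopa–Leindler inequality** at the midpoint, for densities on `[-1,1]^n`. -/
theorem integral_mul_le_sq_of_mul_le_sq {n : ℕ} {u v h : (Fin n → ℝ) → ℝ} (hu : IsCubeDensity u)
    (hv : IsCubeDensity v) (hh : IsCubeDensity h)
    (H : ∀ x y, u x * v y ≤ h ((1 / 2 : ℝ) • (x + y)) ^ 2) :
    (∫ x, u x) * ∫ x, v x ≤ (∫ x, h x) ^ 2 := by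
  induction n with
  | zero =>
    simp only [volume_pi, Measure.pi_of_empty (fun _ : Fin 0 => (volume : Measure ℝ)) 0,
      integral_dirac]
    convert H 0 0
  | succ n ih =>
    rw [hu.integral_eq_integral_section, hv.integral_eq_integral_section,
      hh.integral_eq_integral_section]
    obtain ⟨M, hM⟩ := hu.exists_integral_section_le
    obtain ⟨M', hM'⟩ := hv.exists_integral_section_le
    have nn : ∀ {f : (Fin (n + 1) → ℝ) → ℝ}, IsCubeDensity f → ∀ t,
        0 ≤ ∫ x : Fin n → ℝ, f (Fin.cons t x) := fun hf t =>
      integral_nonneg fun x => hf.nonneg _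
    -- The marginals along the first coordinate satisfy the one-dimensional hypothesis: this is the
    -- induction hypothesis for the sections at `s`, `t` and their midpoint.
    have key := lintegral_mul_le_sq_of_mul_le_sq hu.measurable_integral_section
      hv.measurable_integral_section hh.measurable_integral_section (nn hu) (nn hv) (nn hh)
      (fun t => (hM t).trans (le_max_left M M')) (fun t => (hM' t).trans (le_max_right M M'))
      (fun s t => ih (hu.section_cons s) (hv.section_cons t) (hh.section_cons _) fun x y => by
        convert H (Fin.cons s x) (Fin.cons t y) using 3
        ext i
        refine Fin.cases ?_ (fun i => ?_) i
        · simp; ring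
        · simp; ring)
    rw [← ofReal_integral_eq_lintegral_ofReal hu.integrable_integral_section (.of_forall (nn hu)),
      ← ofReal_integral_eq_lintegral_ofReal hv.integrable_integral_section (.of_forall (nn hv)),
      ← ofReal_integral_eq_lintegral_ofReal hh.integrable_integral_section (.of_forall (nn hh)),
      ← ENNReal.ofReal_mul (integral_nonneg (nn hu)),
      ← ENNReal.ofReal_pow (integral_nonneg (nn hh))] at key
    exact (ENNReal.ofReal_le_ofReal_iff (by positivity)).1 key

/-! ### Strong concavity and Lipschitz functions on the cube -/

variable {N : ℕ}

theorem convex_cube : Convex ℝ (cube N) := convex_Icc _ _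

theorem HasNegSemidefHessian.continuousOn {H : (Fin N → ℝ) → ℝ} (h : HasNegSemidefHessian H) :
    ContinuousOn H (cube N) := h.1.continuousOn

/-- The second derivative along a segment is the Hessian form in its direction. Derivatives within
the cube compose with the segment even when it runs inside a face. -/
theorem HasNegSemidefHessian.concaveOn_segment {H : (Fin N → ℝ) → ℝ} (h : HasNegSemidefHessian H)
    {x y : Fin N → ℝ} (hx : x ∈ cube N) (hy : y ∈ cube N) :
    ConcaveOn ℝ (Set.Icc (0 : ℝ) 1) fun t => H (x + t • (y - x)) := by
  set γ : ℝ → Fin N → ℝ := fun t => x + t • (y - x) with hγ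
  have hmaps : Set.MapsTo γ (Set.Icc 0 1) (cube N) := fun t ht =>
    convex_cube.add_smul_sub_mem hx hy ht
  have hmaps' : Set.MapsTo γ (interior (Set.Icc 0 1)) (cube N) := hmaps.mono_left interior_subset
  have hγd : ∀ t s, HasDerivWithinAt γ (y - x) s t := fun t s => by
    have := ((hasDerivWithinAt_id t s).smul_const (y - x)).const_add x
    rwa [one_smul] at this
  refine concaveOn_of_hasDerivWithinAt2_nonpos (convex_Icc 0 1)
    (h.continuousOn.comp (by fun_prop) hmaps)
    (f' := fun t => fderivWithin ℝ H (cube N) (γ t) (y - x))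
    (f'' := fun t => fderivWithin ℝ (fderivWithin ℝ H (cube N)) (cube N) (γ t) (y - x) (y - x))
    (fun t ht => ?_) (fun t ht => ?_) (fun t ht => h.2.2 _ (hmaps' ht) _)
  · exact (h.1 _ (hmaps' ht)).hasFDerivWithinAt.comp_hasDerivWithinAt t (hγd t _) hmaps'
  · have := (h.2.1 _ (hmaps' ht)).hasFDerivWithinAt.comp_hasDerivWithinAt t (hγd t _) hmaps'
    simpa using this.clm_apply (hasDerivWithinAt_const t _ (y - x))

theorem HasNegSemidefHessian.add_le_two_mul_midpoint {H : (Fin N → ℝ) → ℝ}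
    (h : HasNegSemidefHessian H) {x y : Fin N → ℝ} (hx : x ∈ cube N) (hy : y ∈ cube N) :
    H x + H y ≤ 2 * H ((1 / 2 : ℝ) • (x + y)) := by
  have hc := (h.concaveOn_segment hx hy).2
  have := hc (Set.left_mem_Icc.2 zero_le_one) (Set.right_mem_Icc.2 zero_le_one)
    (by norm_num : (0 : ℝ) ≤ 1 / 2) (by norm_num : (0 : ℝ) ≤ 1 / 2) (by norm_num)
  have e : x + ((1 / 2 : ℝ) • (0 : ℝ) + (1 / 2 : ℝ) • (1 : ℝ)) • (y - x)
      = (1 / 2 : ℝ) • (x + y) := by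
    ext i; simp; ring
  simp only [e] at this
  simp only [zero_smul, add_zero, one_smul, add_sub_cancel, smul_eq_mul] at this
  linarith

/-- Strong concavity at midpoints on the cube, with modulus `ε`. -/
def StronglyMidConcave (ε : ℝ) (G : (Fin N → ℝ) → ℝ) : Prop :=
  ∀ x ∈ cube N, ∀ y ∈ cube N,
    G x + G y ≤ 2 * G ((1 / 2 : ℝ) • (x + y)) - ε / 4 * ∑ i, (x i - y i) ^ 2

/-- The parallelogram identity gives the quadratic term exactly the defect `ε / 4`, and `H` only
adds concavity. -/
theorem HasNegSemidefHessian.stronglyMidConcave {H : (Fin N → ℝ) → ℝ}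
    (h : HasNegSemidefHessian H) (ε : ℝ) :
    StronglyMidConcave ε (regularisedHamiltonian H ε) := by
  intro x hx y hy
  have h1 := h.add_le_two_mul_midpoint hx hy
  have h2 : gaussHamiltonian ε x + gaussHamiltonian ε y
      = 2 * gaussHamiltonian ε ((1 / 2 : ℝ) • (x + y)) - ε / 4 * ∑ i, (x i - y i) ^ 2 := by
    simp only [gaussHamiltonian, Finset.mul_sum, ← Finset.sum_add_distrib,
      ← Finset.sum_sub_distrib, Pi.smul_apply, Pi.add_apply, smul_eq_mul]
    refine Finset.sum_congr rfl fun i _ => by ring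
  simp only [regularisedHamiltonian]
  linarith

/-- `f` is Lipschitz on the cube for the Euclidean distance, with constant `L`. -/
def EuclideanLipschitz (L : ℝ) (f : (Fin N → ℝ) → ℝ) : Prop :=
  ∀ x ∈ cube N, ∀ y ∈ cube N, f x - f y ≤ L * √(∑ i, (x i - y i) ^ 2)

theorem EuclideanLipschitz.const_mul {L : ℝ} {f : (Fin N → ℝ) → ℝ} (hf : EuclideanLipschitz L f)
    {c : ℝ} (hc : 0 ≤ c) : EuclideanLipschitz (c * L) fun x => c * f x := fun x hx y hy => by
  have := mul_le_mul_of_nonneg_left (hf x hx y hy) hc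
  linarith

theorem EuclideanLipschitz.continuousOn {L : ℝ} {f : (Fin N → ℝ) → ℝ}
    (hf : EuclideanLipschitz L f) : ContinuousOn f (cube N) := by
  intro x hx
  have hlim : Tendsto (fun y : Fin N → ℝ => L * √(∑ i, (y i - x i) ^ 2)) (𝓝[cube N] x) (𝓝 0) := by
    have : Continuous fun y : Fin N → ℝ => L * √(∑ i, (y i - x i) ^ 2) := by fun_prop
    simpa using (this.tendsto x).mono_left nhdsWithin_le_nhds
  rw [ContinuousWithinAt, tendsto_iff_dist_tendsto_zero]
  refine squeeze_zero' (.of_forall fun _ => dist_nonneg) ?_ hlim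
  filter_upwards [self_mem_nhdsWithin] with y hy
  rw [Real.dist_eq, abs_sub_le_iff]
  refine ⟨hf y hy x hx, (hf x hx y hy).trans_eq ?_⟩
  simp_rw [← neg_sub (x _) (y _), neg_sq]

/-! ### Concentration and stability of Gibbs measures -/

section Gibbs

theorem integrableOn_cube {f : (Fin N → ℝ) → ℝ} (hf : ContinuousOn f (cube N)) :
    Integrable f (volume.restrict (cube N)) :=
  hf.integrableOn_compact (isCompact_cube N)

theorem volume_cube_ne_zero : volume (cube N) ≠ 0 := by
  simp [cube, Real.volume_Icc_pi]

instance : NeZero ((volume : Measure (Fin N → ℝ)).restrict (cube N)) :=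
  ⟨by rw [Ne, Measure.restrict_eq_zero]; exact volume_cube_ne_zero⟩

theorem integrable_exp_cube {G : (Fin N → ℝ) → ℝ} (hG : ContinuousOn G (cube N)) :
    Integrable (fun x => Real.exp (G x)) (volume.restrict (cube N)) :=
  integrableOn_cube (Real.continuous_exp.comp_continuousOn hG)

theorem isProbabilityMeasure_gibbs {G : (Fin N → ℝ) → ℝ} (hG : ContinuousOn G (cube N)) :
    IsProbabilityMeasure (gibbs G) :=
  isProbabilityMeasure_tilted (integrable_exp_cube hG)

theorem partitionFunction_pos {G : (Fin N → ℝ) → ℝ} (hG : ContinuousOn G (cube N)) :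
    0 < partitionFunction G :=
  integral_exp_pos (integrable_exp_cube hG)

theorem integral_gibbs (G f : (Fin N → ℝ) → ℝ) :
    ∫ x, f x ∂(gibbs G) = (∫ x in cube N, f x * Real.exp (G x)) / partitionFunction G := by
  rw [gibbs, integral_tilted, partitionFunction, ← integral_div]
  refine integral_congr_ae (.of_forall fun x => ?_)
  simp only [smul_eq_mul]
  ring

theorem integrable_gibbs {G f : (Fin N → ℝ) → ℝ} (hG : ContinuousOn G (cube N))
    (hf : ContinuousOn f (cube N)) : Integrable f (gibbs G) := by
  rw [gibbs, integrable_tilted_iff (integrable_exp_cube hG)]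
  exact integrableOn_cube ((Real.continuous_exp.comp_continuousOn hG).smul hf)

theorem gibbs_add {G V : (Fin N → ℝ) → ℝ} (hG : ContinuousOn G (cube N)) :
    gibbs (G + V) = (gibbs G).tilted V :=
  (tilted_tilted (integrable_exp_cube hG) V).symm

theorem exp_integral_gibbs_le {G f : (Fin N → ℝ) → ℝ} (hG : ContinuousOn G (cube N))
    (hf : ContinuousOn f (cube N)) :
    Real.exp (∫ x, f x ∂(gibbs G)) ≤ ∫ x, Real.exp (f x) ∂(gibbs G) := by
  have := isProbabilityMeasure_gibbs hG
  exact convexOn_exp.map_integral_le Real.continuous_exp.continuousOn isClosed_univ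
    (by simp) (integrable_gibbs hG hf)
    (integrable_gibbs hG (Real.continuous_exp.comp_continuousOn hf))

theorem isCubeDensity_indicator_exp {G : (Fin N → ℝ) → ℝ} (hG : ContinuousOn G (cube N)) :
    IsCubeDensity ((cube N).indicator fun x => Real.exp (G x)) where
  measurable := by
    classical
    have := (Real.continuous_exp.comp_continuousOn hG).measurable_piecewise
      (continuousOn_const (c := (0 : ℝ))) (measurableSet_cube N)
    rw [← Set.piecewise_eq_indicator]
    exact this
  nonneg x := Set.indicator_nonneg (fun _ _ => (Real.exp_pos _).le) x
  bdd := by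
    obtain ⟨M, hM⟩ := (isCompact_cube N).bddAbove_image
      (Real.continuous_exp.comp_continuousOn hG)
    refine ⟨max M 0, fun x => ?_⟩
    by_cases hx : x ∈ cube N
    · rw [Set.indicator_of_mem hx]
      exact le_max_of_le_left (hM ⟨x, hx, rfl⟩)
    · rw [Set.indicator_of_notMem hx]
      exact le_max_right _ _
  support x hx := Set.indicator_of_notMem hx _

/-- Maurey's property `(τ)` for strongly log-concave measures, for Lipschitz functions. -/
theorem integral_exp_mul_integral_exp_neg_le {G f : (Fin N → ℝ) → ℝ} {ε L : ℝ} (hε : 0 < ε)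
    (hG : ContinuousOn G (cube N)) (hGc : StronglyMidConcave ε G) (hf : EuclideanLipschitz L f) :
    (∫ x, Real.exp (f x) ∂(gibbs G)) * ∫ x, Real.exp (-f x) ∂(gibbs G)
      ≤ Real.exp (L ^ 2 / ε) := by
  have hfc := hf.continuousOn
  have key := integral_mul_le_sq_of_mul_le_sq (isCubeDensity_indicator_exp (hfc.add hG))
    (isCubeDensity_indicator_exp (hfc.neg.add hG))
    (isCubeDensity_indicator_exp ((continuousOn_const (c := L ^ 2 / (2 * ε))).add hG))
    (fun x y => by
      by_cases hx : x ∈ cube N; swap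
      · rw [Set.indicator_of_notMem hx, zero_mul]; positivity
      by_cases hy : y ∈ cube N; swap
      · rw [Set.indicator_of_notMem hy, mul_zero]; positivity
      have hm : (1 / 2 : ℝ) • (x + y) ∈ cube N := by
        have := convex_cube hx hy (a := 1 / 2) (b := 1 / 2) (by norm_num) (by norm_num)
          (by norm_num)
        rwa [smul_add]
      rw [Set.indicator_of_mem hx, Set.indicator_of_mem hy, Set.indicator_of_mem hm,
        ← Real.exp_add, ← Real.exp_nat_mul, Real.exp_le_exp]
      have h1 := hGc x hx y hy
      have h2 := hf x hx y hy
      have h3 : (0 : ℝ) ≤ ∑ i, (x i - y i) ^ 2 := by positivity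
      set r := √(∑ i, (x i - y i) ^ 2) with hr
      rw [← Real.sq_sqrt h3, ← hr] at h1
      -- Completing the square: the gain from strong concavity absorbs the variation of `f` at the
      -- price `L ^ 2 / ε`. The midpoint density enters squared, so it carries half of this price.
      have h4 : L * r ≤ L ^ 2 / ε + ε / 4 * r ^ 2 := by
        have : L ^ 2 / ε + ε / 4 * r ^ 2 - L * r = (L - ε * r / 2) ^ 2 / ε := by
          field_simp; ring
        have h5 : 0 ≤ (L - ε * r / 2) ^ 2 / ε := by positivity
        linarith
      have h6 : L ^ 2 / (2 * ε) = L ^ 2 / ε / 2 := by rw [div_div, mul_comm]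
      simp only [Pi.add_apply, Pi.neg_apply, Nat.cast_ofNat]
      rw [h6]
      linarith)
  simp only [integral_indicator (measurableSet_cube N), Pi.add_apply, Pi.neg_apply,
    Real.exp_add, integral_const_mul] at key
  rw [integral_gibbs, integral_gibbs]
  have hZ := partitionFunction_pos hG
  rw [div_mul_div_comm, div_le_iff₀ (by positivity)]
  refine key.trans_eq ?_
  rw [mul_pow, ← Real.exp_nat_mul, partitionFunction]
  have : ((2 : ℕ) : ℝ) * (L ^ 2 / (2 * ε)) = L ^ 2 / ε := by push_cast; field_simp
  rw [this, sq (∫ _ in _, _)]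

/-- Sub-Gaussian concentration of Lipschitz functions under a strongly log-concave measure. -/
theorem integral_exp_gibbs_le {G f : (Fin N → ℝ) → ℝ} {ε L : ℝ} (hε : 0 < ε)
    (hG : ContinuousOn G (cube N)) (hGc : StronglyMidConcave ε G) (hf : EuclideanLipschitz L f) :
    ∫ x, Real.exp (f x) ∂(gibbs G) ≤ Real.exp ((∫ x, f x ∂(gibbs G)) + L ^ 2 / ε) := by
  have h1 := integral_exp_mul_integral_exp_neg_le hε hG hGc hf
  -- Jensen bounds the factor with `-f` from below by the exponential of minus the mean of `f`.
  have h2 := exp_integral_gibbs_le hG hf.continuousOn.neg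
  simp only [Pi.neg_apply, integral_neg] at h2
  have h3 : 0 ≤ ∫ x, Real.exp (f x) ∂(gibbs G) := integral_nonneg fun _ => (Real.exp_pos _).le
  have h4 := (mul_le_mul_of_nonneg_left h2 h3).trans h1
  rw [Real.exp_neg, ← div_eq_mul_inv, div_le_iff₀ (Real.exp_pos _)] at h4
  rwa [Real.exp_add, mul_comm]

/-- The Gibbs variational principle for the perturbed measure, as an inequality. -/
theorem integral_gibbs_add_le {G V g : (Fin N → ℝ) → ℝ}
    (hG : ContinuousOn G (cube N)) (hV : ContinuousOn V (cube N)) (hg : ContinuousOn g (cube N)) :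
    Real.exp (∫ x, g x ∂(gibbs (G + V)) - ∫ x, V x ∂(gibbs (G + V)) + ∫ x, V x ∂(gibbs G))
      ≤ ∫ x, Real.exp (g x) ∂(gibbs G) := by
  -- Jensen twice: for `V` under the measure of `G`, and for `g - V` under that of `G + V`. In the
  -- second, the tilt cancels `exp (-V)` and leaves a ratio of exponential moments under `G`.
  have hY := exp_integral_gibbs_le hG hV
  have h1 := exp_integral_gibbs_le (hG.add hV) (hg.sub hV)
  simp only [Pi.sub_apply] at h1
  rw [integral_sub (integrable_gibbs (hG.add hV) hg) (integrable_gibbs (hG.add hV) hV)] at h1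
  have h2 : ∫ x, Real.exp (g x - V x) ∂(gibbs (G + V))
      = (∫ x, Real.exp (g x) ∂(gibbs G)) / ∫ x, Real.exp (V x) ∂(gibbs G) := by
    rw [gibbs_add hG, integral_tilted, ← integral_div]
    refine integral_congr_ae (.of_forall fun x => ?_)
    simp only [smul_eq_mul, Real.exp_sub]
    field_simp
  rw [h2, le_div_iff₀ ((Real.exp_pos _).trans_le hY)] at h1
  rw [Real.exp_add]
  exact (mul_le_mul_of_nonneg_left hY (Real.exp_pos _).le).trans h1

/-- A Lipschitz perturbation moves a strongly log-concave measure little in the `W₁` distance. -/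
theorem integral_gibbs_add_sub_integral_gibbs_le {G V f : (Fin N → ℝ) → ℝ} {ε L B : ℝ}
    (hε : 0 < ε) (hL : 0 < L) (hB : 0 < B)
    (hG : ContinuousOn G (cube N)) (hGc : StronglyMidConcave ε G)
    (hV : EuclideanLipschitz B V) (hf : EuclideanLipschitz L f) :
    ∫ x, f x ∂(gibbs (G + V)) - ∫ x, f x ∂(gibbs G) ≤ 4 * L * B / ε := by
  set D := ∫ x, V x ∂(gibbs (G + V)) - ∫ x, V x ∂(gibbs G) with hD
  -- `D` dominates the relative entropy of the perturbed measure with respect to the original one,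
  -- so this is the entropy inequality with the sub-Gaussian bound inserted.
  have key : ∀ {g : (Fin N → ℝ) → ℝ} {K δ : ℝ}, 0 ≤ δ → EuclideanLipschitz K g →
      δ * (∫ x, g x ∂(gibbs (G + V)) - ∫ x, g x ∂(gibbs G)) ≤ δ ^ 2 * K ^ 2 / ε + D := by
    intro g K δ hδ hg
    have h := (integral_gibbs_add_le hG hV.continuousOn (hg.const_mul hδ).continuousOn).trans
      (integral_exp_gibbs_le hε hG hGc (hg.const_mul hδ))
    rw [Real.exp_le_exp, integral_const_mul, integral_const_mul, mul_pow] at h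
    linarith
  -- Testing `V` itself with `δ = 2` bounds `D` by `4 * B ^ 2 / ε`. The choice `δ = 2 * B / L` for
  -- `f` then makes the quadratic term equal to the same quantity.
  have h1 := key (δ := 2) (by norm_num) hV
  have h2 := key (δ := 2 * B / L) (by positivity) hf
  rw [← hD] at h1
  have h3 : (2 * B / L) ^ 2 * L ^ 2 / ε = 2 ^ 2 * B ^ 2 / ε := by field_simp
  rw [h3] at h2
  have h4 : (2 * B / L) * (∫ x, f x ∂(gibbs (G + V)) - ∫ x, f x ∂(gibbs G))
      ≤ (2 * B / L) * (4 * L * B / ε) := by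
    have : (2 * B / L) * (4 * L * B / ε) = 2 * (2 ^ 2 * B ^ 2 / ε) := by field_simp; ring
    linarith
  exact le_of_mul_le_mul_left h4 (by positivity)

end Gibbs

/-! ### From Lipschitz stability to multioverlaps -/

theorem abs_prod_sub_prod_le {ι : Type*} (s : Finset ι) {a b : ι → ℝ} (ha : ∀ i, |a i| ≤ 1)
    (hb : ∀ i, |b i| ≤ 1) : |∏ i ∈ s, a i - ∏ i ∈ s, b i| ≤ ∑ i ∈ s, |a i - b i| := by
  classical
  induction s using Finset.induction_on with
  | empty => simp
  | insert i s hi ih =>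
    rw [Finset.prod_insert hi, Finset.prod_insert hi, Finset.sum_insert hi]
    have hs : |∏ j ∈ s, b j| ≤ 1 := by
      rw [Finset.abs_prod]
      exact Finset.prod_le_one (fun _ _ => abs_nonneg _) fun j _ => hb j
    calc |a i * ∏ j ∈ s, a j - b i * ∏ j ∈ s, b j|
        = |a i * (∏ j ∈ s, a j - ∏ j ∈ s, b j) + (a i - b i) * ∏ j ∈ s, b j| := by
          congr 1; ring
      _ ≤ |a i| * |∏ j ∈ s, a j - ∏ j ∈ s, b j| + |a i - b i| * |∏ j ∈ s, b j| := by
          rw [← abs_mul, ← abs_mul]; exact abs_add_le _ _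
      _ ≤ 1 * (∑ j ∈ s, |a j - b j|) + |a i - b i| * 1 := by
          gcongr
          exact ha i
      _ = _ := by ring

theorem abs_pow_sub_pow_le_mul {x y : ℝ} (hx : |x| ≤ 1) (hy : |y| ≤ 1) (k : ℕ) :
    |x ^ k - y ^ k| ≤ k * |x - y| := by
  refine (abs_pow_sub_pow_le x y k).trans ?_
  have : max |x| |y| ^ (k - 1) ≤ 1 := pow_le_one₀ (by positivity) (max_le hx hy)
  calc |x - y| * k * max |x| |y| ^ (k - 1) ≤ |x - y| * k * 1 := by gcongr
    _ = _ := by ring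

theorem abs_le_one_of_mem_cube {x : Fin N → ℝ} (hx : x ∈ cube N) (i : Fin N) : |x i| ≤ 1 :=
  abs_le.2 (mem_cube_iff.1 hx i)

theorem sum_abs_le_sqrt_mul_sqrt (a : Fin N → ℝ) : ∑ i, |a i| ≤ √N * √(∑ i, a i ^ 2) := by
  rw [← Real.sqrt_mul (by positivity)]
  refine Real.le_sqrt_of_sq_le ?_
  simpa using sq_sum_le_card_mul_sum_sq (s := (Finset.univ : Finset (Fin N))) (f := fun i => |a i|)

theorem ae_mem_cube_gibbs (G : (Fin N → ℝ) → ℝ) : ∀ᵐ x ∂(gibbs G), x ∈ cube N :=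
  (tilted_absolutelyContinuous _ G).ae_le (ae_restrict_mem (measurableSet_cube N))

theorem abs_integral_pow_gibbs_le {G : (Fin N → ℝ) → ℝ} (hG : ContinuousOn G (cube N))
    (i : Fin N) (k : ℕ) : |∫ x, x i ^ k ∂(gibbs G)| ≤ 1 := by
  have := isProbabilityMeasure_gibbs hG
  have h : ∀ᵐ x ∂(gibbs G), ‖x i ^ k‖ ≤ 1 := by
    filter_upwards [ae_mem_cube_gibbs G] with x hx
    rw [Real.norm_eq_abs, abs_pow]
    exact pow_le_one₀ (abs_nonneg _) (abs_le_one_of_mem_cube hx i)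
  simpa using norm_integral_le_of_norm_le_const h

/-- Independence of the replicas factorises the mean at each site, which reduces the comparison to
one-replica moments. -/
theorem thermalMean_multioverlap {n : ℕ} {G : (Fin N → ℝ) → ℝ} (hG : ContinuousOn G (cube N))
    (k : Fin n → ℕ) :
    thermalMean G (multioverlap k) = (N : ℝ)⁻¹ * ∑ i, ∏ l, ∫ x, x i ^ k l ∂(gibbs G) := by
  have := isProbabilityMeasure_gibbs hG
  simp only [thermalMean, multioverlap]
  rw [integral_const_mul, integral_finsetSum]
  · congr 1
    refine Finset.sum_congr rfl fun i _ => ?_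
    exact integral_fintype_prod_eq_prod (μ := fun _ : Fin n => gibbs G)
      (fun l (x : Fin N → ℝ) => x i ^ k l)
  · intro i _
    exact Integrable.fintype_prod (μ := fun _ : Fin n => gibbs G)
      (f := fun l (x : Fin N → ℝ) => x i ^ k l)
      fun l => integrable_gibbs hG (by fun_prop)

/-- Cauchy–Schwarz over the sites yields the factor `1 / √N`. The constant has `k + 1` in place of
`k` so that it stays positive for `k = 0`. -/
theorem euclideanLipschitz_signed_moment (hN : 0 < N) {η : Fin N → ℝ} (hη : ∀ i, |η i| ≤ 1)
    (k : ℕ) :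
    EuclideanLipschitz ((k + 1) / √N) fun x : Fin N → ℝ => (N : ℝ)⁻¹ * ∑ i, η i * x i ^ k := by
  intro x hx y hy
  have hN' : (0 : ℝ) < N := by exact_mod_cast hN
  have h1 : ∀ i, η i * x i ^ k - η i * y i ^ k ≤ (k + 1) * |x i - y i| := fun i => by
    have h := abs_pow_sub_pow_le_mul (abs_le_one_of_mem_cube hx i) (abs_le_one_of_mem_cube hy i) k
    calc η i * x i ^ k - η i * y i ^ k ≤ |η i * (x i ^ k - y i ^ k)| := by
          rw [← mul_sub]; exact le_abs_self _
      _ = |η i| * |x i ^ k - y i ^ k| := abs_mul _ _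
      _ ≤ 1 * (k * |x i - y i|) := by gcongr; exact hη i
      _ ≤ _ := by nlinarith [abs_nonneg (x i - y i)]
  rw [← mul_sub, ← Finset.sum_sub_distrib]
  calc (N : ℝ)⁻¹ * ∑ i, (η i * x i ^ k - η i * y i ^ k)
      ≤ (N : ℝ)⁻¹ * ∑ i, (k + 1) * |x i - y i| := by gcongr with i; exact h1 i
    _ ≤ (N : ℝ)⁻¹ * ((k + 1) * (√N * √(∑ i, (x i - y i) ^ 2))) := by
        rw [← Finset.mul_sum]; gcongr; exact sum_abs_le_sqrt_mul_sqrt _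
    _ = _ := by
        have : (N : ℝ)⁻¹ * √N = 1 / √N := by
          rw [Real.sqrt_div_self'.symm]; ring
        calc _ = ((N : ℝ)⁻¹ * √N) * ((k + 1) * √(∑ i, (x i - y i) ^ 2)) := by ring
          _ = _ := by rw [this]; ring

/-- With the signs of the differences as coefficients, the average of absolute values becomes the
change in mean of a single Lipschitz observable. -/
theorem mean_abs_moment_sub_le {G V : (Fin N → ℝ) → ℝ} {ε B : ℝ} (hN : 0 < N)
    (hε : 0 < ε) (hB : 0 < B) (hG : ContinuousOn G (cube N)) (hGc : StronglyMidConcave ε G)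
    (hV : EuclideanLipschitz B V) (k : ℕ) :
    (N : ℝ)⁻¹ * ∑ i, |∫ x, x i ^ k ∂(gibbs (G + V)) - ∫ x, x i ^ k ∂(gibbs G)|
      ≤ 4 * ((k + 1) / √N) * B / ε := by
  have hN' : (0 : ℝ) < N := by exact_mod_cast hN
  set d : Fin N → ℝ := fun i => ∫ x, x i ^ k ∂(gibbs (G + V)) - ∫ x, x i ^ k ∂(gibbs G) with hd
  set η : Fin N → ℝ := fun i => SignType.sign (d i) with hη
  have hη1 : ∀ i, |η i| ≤ 1 := fun i => by
    simp only [hη]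
    rcases SignType.sign (d i) <;> simp
  have h := integral_gibbs_add_sub_integral_gibbs_le hε (by positivity) hB hG hGc hV
    (euclideanLipschitz_signed_moment hN hη1 k)
  have hexp : ∀ G' : (Fin N → ℝ) → ℝ, ContinuousOn G' (cube N) →
      ∫ x, (N : ℝ)⁻¹ * ∑ i, η i * x i ^ k ∂(gibbs G')
        = (N : ℝ)⁻¹ * ∑ i, η i * ∫ x, x i ^ k ∂(gibbs G') := by
    intro G' hG'
    rw [integral_const_mul, integral_finsetSum]
    · simp_rw [integral_const_mul]
    · exact fun i _ => (integrable_gibbs hG' (by fun_prop))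
  rw [hexp _ (hG.add hV.continuousOn), hexp _ hG, ← mul_sub, ← Finset.sum_sub_distrib] at h
  refine le_trans (le_of_eq ?_) h
  congr 1
  refine Finset.sum_congr rfl fun i _ => ?_
  rw [← mul_sub, ← sign_mul_self]

/-- All moments are at most `1` in absolute value, so a difference of products is at most the sum of
the differences of the factors. -/
theorem abs_thermalMean_multioverlap_sub_le {n : ℕ} {G V : (Fin N → ℝ) → ℝ} {ε B : ℝ}
    (hN : 0 < N) (hε : 0 < ε) (hB : 0 < B) (hG : ContinuousOn G (cube N))
    (hGc : StronglyMidConcave ε G) (hV : EuclideanLipschitz B V) (k : Fin n → ℕ) :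
    |thermalMean (G + V) (multioverlap k) - thermalMean G (multioverlap k)|
      ≤ (4 * ∑ l, ((k l : ℝ) + 1)) * (B / (ε * √N)) := by
  have hGV := hG.add hV.continuousOn
  rw [thermalMean_multioverlap hG, thermalMean_multioverlap hGV, ← mul_sub,
    ← Finset.sum_sub_distrib, abs_mul, abs_of_nonneg (by positivity : (0 : ℝ) ≤ (N : ℝ)⁻¹)]
  calc _ ≤ (N : ℝ)⁻¹ * ∑ i, ∑ l,
        |∫ x, x i ^ k l ∂(gibbs (G + V)) - ∫ x, x i ^ k l ∂(gibbs G)| := by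
        gcongr
        refine (Finset.abs_sum_le_sum_abs _ _).trans (Finset.sum_le_sum fun i _ => ?_)
        exact abs_prod_sub_prod_le _ (fun l => abs_integral_pow_gibbs_le hGV i (k l))
          (fun l => abs_integral_pow_gibbs_le hG i (k l))
    _ = ∑ l, (N : ℝ)⁻¹ * ∑ i,
        |∫ x, x i ^ k l ∂(gibbs (G + V)) - ∫ x, x i ^ k l ∂(gibbs G)| := by
        rw [Finset.sum_comm, Finset.mul_sum]
    _ ≤ ∑ l, 4 * (((k l : ℝ) + 1) / √N) * B / ε :=
        Finset.sum_le_sum fun l _ => mean_abs_moment_sub_le hN hε hB hG hGc hV (k l)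
    _ = _ := by
        rw [Finset.mul_sum, Finset.sum_mul]
        refine Finset.sum_congr rfl fun l _ => ?_
        field_simp

theorem abs_thermalMean_multioverlap_le_one {n : ℕ} {G : (Fin N → ℝ) → ℝ}
    (hG : ContinuousOn G (cube N)) (k : Fin n → ℕ) :
    |thermalMean G (multioverlap k)| ≤ 1 := by
  rw [thermalMean_multioverlap hG, abs_mul, abs_of_nonneg (by positivity : (0 : ℝ) ≤ (N : ℝ)⁻¹)]
  calc _ ≤ (N : ℝ)⁻¹ * ∑ _i : Fin N, (1 : ℝ) := by
        gcongr
        refine (Finset.abs_sum_le_sum_abs _ _).trans (Finset.sum_le_sum fun i _ => ?_)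
        rw [Finset.abs_prod]
        exact Finset.prod_le_one (fun _ _ => abs_nonneg _)
          fun l _ => abs_integral_pow_gibbs_le hG i (k l)
    _ ≤ 1 := by simpa using inv_mul_le_one

/-! ### Weights of the perturbation polynomials -/

/-- A bound on `P_I` and on its Lipschitz constant on `[-1,1]`. -/
noncomputable def pertWeight (I : PertIndex) : ℝ≥0 :=
  (1 / 2) ^ ((∑ p, I.2.1 p) + 2 * (I.1 : ℕ)) * (I.1 : ℕ) ^ 2

theorem pertPoly_nonneg (I : PertIndex) {x : ℝ} (hx : x ∈ Set.Icc (-1 : ℝ) 1) :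
    0 ≤ pertPoly I x := by
  have : 0 ≤ x + 1 := by linarith [hx.1]
  unfold pertPoly
  positivity

theorem pertPoly_le (I : PertIndex) {x : ℝ} (hx : x ∈ Set.Icc (-1 : ℝ) 1) :
    pertPoly I x ≤ pertWeight I := by
  have h0 : 0 ≤ x + 1 := by linarith [hx.1]
  have h2 : x + 1 ≤ 2 := by linarith [hx.2]
  have hm : (1 : ℝ) ≤ (I.1 : ℕ) := by exact_mod_cast I.1.pos
  unfold pertPoly pertWeight
  push_cast
  refine mul_le_mul_of_nonneg_left ?_ (by positivity)
  calc ∑ p : Fin I.1, (1 / 2 : ℝ) ^ I.2.1 p * (x + 1) ^ (p : ℕ)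
      ≤ ∑ p : Fin I.1, (1 : ℝ) := by
        refine Finset.sum_le_sum fun p _ => ?_
        calc (1 / 2 : ℝ) ^ I.2.1 p * (x + 1) ^ (p : ℕ)
            ≤ (1 / 2 : ℝ) ^ (p : ℕ) * 2 ^ (p : ℕ) := by
              refine mul_le_mul ?_ (pow_le_pow_left₀ h0 h2 _) (by positivity) (by positivity)
              -- The constraint `i_p ≥ p` is what lets the coefficient cancel the growth `2 ^ p` of
              -- `(x + 1) ^ p`.
              exact pow_le_pow_of_le_one (by norm_num) (by norm_num) (I.2.2 p)
          _ = 1 := by rw [← mul_pow]; norm_num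
    _ ≤ _ := by simp; nlinarith

/-- By the same cancellation each summand has slope at most its degree, hence at most `m`; summing
`m` of them accounts for the square in `pertWeight`. -/
theorem abs_pertPoly_sub_le (I : PertIndex) {x y : ℝ} (hx : x ∈ Set.Icc (-1 : ℝ) 1)
    (hy : y ∈ Set.Icc (-1 : ℝ) 1) :
    |pertPoly I x - pertPoly I y| ≤ pertWeight I * |x - y| := by
  have hx0 : 0 ≤ x + 1 := by linarith [hx.1]
  have hx2 : x + 1 ≤ 2 := by linarith [hx.2]
  have hy0 : 0 ≤ y + 1 := by linarith [hy.1]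
  have hy2 : y + 1 ≤ 2 := by linarith [hy.2]
  unfold pertPoly pertWeight
  push_cast
  rw [← mul_sub, abs_mul, abs_of_nonneg (by positivity), mul_assoc]
  refine mul_le_mul_of_nonneg_left ?_ (by positivity)
  rw [← Finset.sum_sub_distrib]
  calc |∑ p : Fin I.1, ((1 / 2 : ℝ) ^ I.2.1 p * (x + 1) ^ (p : ℕ)
        - (1 / 2 : ℝ) ^ I.2.1 p * (y + 1) ^ (p : ℕ))|
      ≤ ∑ p : Fin I.1, ((I.1 : ℕ) : ℝ) * |x - y| := by
        refine (Finset.abs_sum_le_sum_abs _ _).trans (Finset.sum_le_sum fun p _ => ?_)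
        rw [← mul_sub, abs_mul, abs_of_nonneg (by positivity)]
        have h1 : |(x + 1) ^ (p : ℕ) - (y + 1) ^ (p : ℕ)| ≤ 2 ^ (p : ℕ) * (p * |x - y|) := by
          refine (abs_pow_sub_pow_le _ _ _).trans ?_
          rw [add_sub_add_right_eq_sub, abs_of_nonneg hx0, abs_of_nonneg hy0]
          have : max (x + 1) (y + 1) ^ ((p : ℕ) - 1) ≤ 2 ^ (p : ℕ) :=
            (pow_le_pow_left₀ (by positivity) (max_le hx2 hy2) _).trans
              (pow_le_pow_right₀ (by norm_num) (Nat.sub_le _ _))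
          calc |x - y| * p * max (x + 1) (y + 1) ^ ((p : ℕ) - 1)
              ≤ |x - y| * p * 2 ^ (p : ℕ) := by gcongr
            _ = _ := by ring
        have h2 : (1 / 2 : ℝ) ^ I.2.1 p ≤ (1 / 2) ^ (p : ℕ) :=
          pow_le_pow_of_le_one (by norm_num) (by norm_num) (I.2.2 p)
        calc (1 / 2 : ℝ) ^ I.2.1 p * |(x + 1) ^ (p : ℕ) - (y + 1) ^ (p : ℕ)|
            ≤ (1 / 2) ^ (p : ℕ) * (2 ^ (p : ℕ) * (p * |x - y|)) := by gcongr
          _ = ((1 / 2) ^ (p : ℕ) * 2 ^ (p : ℕ)) * (p * |x - y|) := by ring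
          _ = p * |x - y| := by rw [← mul_pow]; norm_num
          _ ≤ _ := by gcongr; exact p.2.le
    _ = _ := by simp; ring

theorem tsum_pi_prod (f : ℕ → ℝ≥0∞) (m : ℕ) :
    ∑' e : Fin m → ℕ, ∏ p, f (e p) = (∑' j, f j) ^ m := by
  induction m with
  | zero => simp
  | succ m ih =>
    rw [← (Fin.consEquiv fun _ : Fin (m + 1) => ℕ).tsum_eq, ENNReal.tsum_prod']
    simp only [Fin.consEquiv, Equiv.coe_fn_mk, Fin.prod_univ_succ, Fin.cons_zero, Fin.cons_succ]
    simp_rw [ENNReal.tsum_mul_left, ih]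
    rw [ENNReal.tsum_mul_right, pow_succ, mul_comm]

/-- Without the constraint `i_p ≥ p`, the sum of `2^{-ι(I)}` over tuples of length `m` is `2 ^ m`.
The factor `2^{-2m}` in the weight beats it and leaves a series summable in `m`. -/
theorem tsum_pertWeight_length_le (m : ℕ+) :
    ∑' e : {e : Fin m → ℕ // ∀ p : Fin m, (p : ℕ) ≤ e p}, (pertWeight ⟨m, e⟩ : ℝ≥0∞)
      ≤ ((((m : ℕ) : ℝ≥0) ^ 2 * (1 / 2) ^ (m : ℕ) : ℝ≥0) : ℝ≥0∞) := by
  have h1 : ∑' e : {e : Fin m → ℕ // ∀ p : Fin m, (p : ℕ) ≤ e p},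
      ∏ p, (2⁻¹ : ℝ≥0∞) ^ (e.1 p) ≤ 2 ^ (m : ℕ) := by
    refine (ENNReal.tsum_comp_le_tsum_of_injective Subtype.val_injective
      (fun e : Fin m → ℕ => ∏ p, (2⁻¹ : ℝ≥0∞) ^ (e p))).trans ?_
    rw [tsum_pi_prod, ENNReal.tsum_geometric, ENNReal.one_sub_inv_two, inv_inv]
  have h2 : ∀ e : {e : Fin m → ℕ // ∀ p : Fin m, (p : ℕ) ≤ e p},
      (pertWeight ⟨m, e⟩ : ℝ≥0∞)
        = (2⁻¹ ^ (2 * (m : ℕ)) * ((m : ℕ) : ℝ≥0∞) ^ 2) * ∏ p, (2⁻¹ : ℝ≥0∞) ^ (e.1 p) := by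
    intro e
    rw [pertWeight, Finset.prod_pow_eq_pow_sum]
    push_cast
    rw [pow_add, one_div]
    ring
  simp_rw [h2, ENNReal.tsum_mul_left]
  refine (mul_le_mul_right h1 _).trans_eq ?_
  have h3 : ((2 : ℝ≥0∞)⁻¹) ^ (m : ℕ) * 2 ^ (m : ℕ) = 1 := by
    rw [← mul_pow, ENNReal.inv_mul_cancel (by simp) (by simp), one_pow]
  push_cast
  rw [two_mul, pow_add, one_div]
  calc _ = ((m : ℕ) : ℝ≥0∞) ^ 2 * 2⁻¹ ^ (m : ℕ) * ((2 : ℝ≥0∞)⁻¹ ^ (m : ℕ) * 2 ^ (m : ℕ)) := by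
        ring
    _ = _ := by rw [h3, mul_one]

theorem tsum_pertWeight_ne_top : ∑' I : PertIndex, (pertWeight I : ℝ≥0∞) ≠ ⊤ := by
  obtain ⟨f, hf⟩ : ∃ f : ℕ → ℝ≥0, ∀ m, f m = (m : ℝ≥0) ^ 2 * (1 / 2) ^ m := ⟨_, fun _ => rfl⟩
  have h1 : Summable f := by
    rw [← NNReal.summable_coe]
    simp_rw [hf]
    push_cast
    exact summable_pow_mul_geometric_of_norm_lt_one 2 (by norm_num)
  have h2 : ∑' m : ℕ+, (f m : ℝ≥0∞) ≠ ⊤ :=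
    ne_top_of_le_ne_top (ENNReal.tsum_coe_ne_top_iff_summable.2 h1)
      (ENNReal.tsum_comp_le_tsum_of_injective PNat.coe_injective fun m => (f m : ℝ≥0∞))
  refine ne_top_of_le_ne_top h2 ?_
  have h3 := ENNReal.tsum_sigma' (fun I : PertIndex => (pertWeight I : ℝ≥0∞))
  refine h3.trans_le (ENNReal.tsum_le_tsum fun m => ?_)
  rw [hf]
  exact tsum_pertWeight_length_le m

/-! ### Poisson counts and collisions -/

/-- Shifting the Poisson series by `r` cancels the falling factorial and leaves `s ^ r` times the
total mass. -/
theorem lintegral_descFactorial_poissonMeasure (s : ℝ≥0) (r : ℕ) :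
    ∫⁻ m, (m.descFactorial r : ℝ≥0∞) ∂(poissonMeasure s) = (s : ℝ≥0∞) ^ r := by
  rw [lintegral_countable']
  simp_rw [poissonMeasure_singleton]
  rw [← Summable.sum_add_tsum_nat_add' (k := r) ENNReal.summable, Finset.sum_eq_zero, zero_add]
  · have h : ∀ m : ℕ, ((m + r).descFactorial r : ℝ≥0∞)
        * ENNReal.ofReal (Real.exp (-s) * s ^ (m + r) / (m + r).factorial)
        = s ^ r * poissonMeasure s {m} := by
      intro m
      rw [poissonMeasure_singleton, ← ENNReal.ofReal_natCast, ← ENNReal.ofReal_mul (by positivity),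
        ← ENNReal.ofReal_coe_nnreal, ← ENNReal.ofReal_pow (by positivity),
        ← ENNReal.ofReal_mul (by positivity)]
      congr 1
      have h1 : ((m.factorial : ℝ)) * (m + r).descFactorial r = (m + r).factorial := by
        have := Nat.factorial_mul_descFactorial (Nat.le_add_left r m)
        rw [Nat.add_sub_cancel] at this
        exact_mod_cast this
      have h2 : (0 : ℝ) < (m + r).descFactorial r := by
        exact_mod_cast Nat.descFactorial_pos.2 (Nat.le_add_left r m)
      rw [← h1, pow_add]
      field_simp
    simp_rw [h, ENNReal.tsum_mul_left]
    have : ∑' m, poissonMeasure s {m} = 1 := by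
      have := lintegral_countable' (μ := poissonMeasure s) (fun _ => 1)
      simpa using this.symm
    rw [this, mul_one]
  · intro m hm
    rw [Nat.descFactorial_eq_zero_iff_lt.2 (Finset.mem_range.1 hm)]
    simp

/-- The number of pairs `(a, b)` with `a, b ≤ π_I` and `U_a = U_b`. -/
def collisions (I : PertIndex) (ω : PertDisorder N) : ℕ :=
  ∑ a ∈ Finset.range (ω.1 I), ∑ b ∈ Finset.range (ω.1 I),
    if ω.2 (I, a) = ω.2 (I, b) then 1 else 0

/-- The diagonal pairs `a = b` are counted, so collisions also control the number of points. -/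
theorem le_collisions (I : PertIndex) (ω : PertDisorder N) : ω.1 I ≤ collisions I ω := by
  calc ω.1 I = ∑ a ∈ Finset.range (ω.1 I), 1 := by simp
    _ ≤ _ := Finset.sum_le_sum fun a ha => by
        rw [← Finset.sum_filter, ← Finset.card_eq_sum_ones]
        exact Finset.card_pos.2 ⟨a, by simp_all⟩

/-- The sums have the random length `π_I`; as it takes countably many values, measurability for each
fixed length suffices. -/
theorem measurable_pert_of_forall {α γ : Type*} [MeasurableSpace α] [MeasurableSpace γ]
    (I : PertIndex) {f : ℕ → (PertIndex × ℕ → Fin N) × α → γ} (hf : ∀ m, Measurable (f m)) :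
    Measurable fun p : PertDisorder N × α => f (p.1.1 I) (p.1.2, p.2) := by
  have h : Measurable fun q : ℕ × ((PertIndex × ℕ → Fin N) × α) => f q.1 q.2 :=
    measurable_from_prod_countable_right hf
  have h2 : Measurable fun p : PertDisorder N × α => (p.1.1 I, (p.1.2, p.2)) := by fun_prop
  exact h.comp h2

theorem measurable_eq_indicator (I : PertIndex) (a b : ℕ) :
    Measurable fun u : PertIndex × ℕ → Fin N => if u (I, a) = u (I, b) then (1 : ℕ) else 0 :=
  Measurable.ite (measurableSet_eq_fun (by fun_prop) (by fun_prop)) measurable_const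
    measurable_const

theorem measurable_collisions (I : PertIndex) :
    Measurable (collisions I : PertDisorder N → ℕ) := by
  have h := measurable_pert_of_forall (N := N) (α := Unit) I
    (f := fun m q => ∑ a ∈ Finset.range m, ∑ b ∈ Finset.range m,
      if q.1 (I, a) = q.1 (I, b) then 1 else 0)
    fun m => Finset.measurable_fun_sum _ fun a _ => Finset.measurable_fun_sum _ fun b _ =>
      (measurable_eq_indicator I a b).comp measurable_fst
  exact h.comp (f := fun ω : PertDisorder N => (ω, ())) (by fun_prop)

/-- The weighted number of collisions. -/
noncomputable def totalCollisions (ω : PertDisorder N) : ℝ≥0∞ :=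
  ∑' I, (pertWeight I : ℝ≥0∞) * collisions I ω

theorem measurable_totalCollisions : Measurable (totalCollisions : PertDisorder N → ℝ≥0∞) :=
  Measurable.tsum fun I =>
    ((measurable_of_countable (fun n : ℕ => (n : ℝ≥0∞))).comp (measurable_collisions I)).const_mul _

theorem lintegral_eq_indicator [NeZero N] (I : PertIndex) {a b : ℕ} (hab : a ≠ b) :
    ∫⁻ u, ((if u (I, a) = u (I, b) then 1 else 0 : ℕ) : ℝ≥0∞)
      ∂(Measure.infinitePi fun _ : PertIndex × ℕ => (PMF.uniformOfFintype (Fin N)).toMeasure)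
      = (N : ℝ≥0∞)⁻¹ := by
  have hne : (I, a) ≠ (I, b) := fun h => hab (Prod.ext_iff.1 h).2
  set ν := (PMF.uniformOfFintype (Fin N)).toMeasure with hν
  have h := Measure.infinitePi_map_eval_prod (P := fun _ : PertIndex × ℕ => ν) hne
  have hm : Measurable fun q : Fin N × Fin N => ((if q.1 = q.2 then 1 else 0 : ℕ) : ℝ≥0∞) :=
    measurable_of_countable _
  have hs : ∀ i, ν {i} = (N : ℝ≥0∞)⁻¹ := fun i => by
    rw [hν, PMF.toMeasure_apply_singleton _ _ (measurableSet_singleton i)]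
    simp
  rw [← lintegral_map (μ := Measure.infinitePi fun _ : PertIndex × ℕ => ν)
    (g := fun u => (u (I, a), u (I, b))) hm (by fun_prop), h, lintegral_prod _ hm.aemeasurable]
  simp only [lintegral_fintype, hs]
  have hN : (N : ℝ≥0∞) ≠ 0 := by exact_mod_cast NeZero.ne N
  simp only [Nat.cast_ite, Nat.cast_one, Nat.cast_zero, ite_mul, one_mul, zero_mul,
    Finset.sum_ite_eq, Finset.mem_univ, if_true, Finset.sum_const, Finset.card_univ,
    Fintype.card_fin, nsmul_eq_mul]
  rw [← mul_assoc, ENNReal.mul_inv_cancel hN (by simp), one_mul]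

/-- There are `m` diagonal pairs and `m (m - 1)` others, each of the latter colliding with
probability `1 / N`. Falling factorials match the Poisson moments. -/
theorem lintegral_collisions_of_count [NeZero N] (I : PertIndex) (m : ℕ) :
    ∫⁻ u, ((∑ a ∈ Finset.range m, ∑ b ∈ Finset.range m,
        if u (I, a) = u (I, b) then 1 else 0 : ℕ) : ℝ≥0∞)
      ∂(Measure.infinitePi fun _ : PertIndex × ℕ => (PMF.uniformOfFintype (Fin N)).toMeasure)
      = m.descFactorial 1 + m.descFactorial 2 * (N : ℝ≥0∞)⁻¹ := by
  have hmeas : ∀ a b, Measurable fun u : PertIndex × ℕ → Fin N =>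
      ((if u (I, a) = u (I, b) then 1 else 0 : ℕ) : ℝ≥0∞) := fun a b =>
    (measurable_of_countable (fun n : ℕ => (n : ℝ≥0∞))).comp (measurable_eq_indicator I a b)
  have hrow : ∀ a ∈ Finset.range m, ∑ b ∈ Finset.range m,
      ∫⁻ u, ((if u (I, a) = u (I, b) then 1 else 0 : ℕ) : ℝ≥0∞)
        ∂(Measure.infinitePi fun _ : PertIndex × ℕ => (PMF.uniformOfFintype (Fin N)).toMeasure)
      = 1 + (m - 1 : ℕ) * (N : ℝ≥0∞)⁻¹ := by
    intro a ha
    rw [← Finset.add_sum_erase _ _ ha]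
    congr 1
    · simp
    · rw [Finset.sum_congr rfl fun b hb =>
        lintegral_eq_indicator I (Finset.ne_of_mem_erase hb).symm]
      simp [Finset.card_erase_of_mem ha]
  push_cast at hmeas hrow ⊢
  rw [lintegral_finsetSum _ fun a _ => Finset.measurable_fun_sum _ fun b _ => hmeas a b]
  simp_rw [lintegral_finsetSum _ fun b _ => hmeas _ b]
  rw [Finset.sum_congr rfl hrow]
  have h2 : m.descFactorial 2 = m * (m - 1) := by
    simp [Nat.descFactorial_succ, mul_comm]
  rw [h2]
  push_cast
  simp [mul_assoc]

theorem lintegral_collisions [NeZero N] (s : ℝ≥0) (I : PertIndex) :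
    ∫⁻ ω, (collisions I ω : ℝ≥0∞) ∂(pertLaw N s) = s + s ^ 2 * (N : ℝ≥0∞)⁻¹ := by
  have hm : Measurable fun ω : PertDisorder N => (collisions I ω : ℝ≥0∞) :=
    (measurable_of_countable (fun n : ℕ => (n : ℝ≥0∞))).comp (measurable_collisions I)
  rw [pertLaw, lintegral_prod _ hm.aemeasurable]
  simp only [collisions]
  simp_rw [lintegral_collisions_of_count]
  rw [← lintegral_map (f := fun m : ℕ => (m.descFactorial 1 : ℝ≥0∞)
      + m.descFactorial 2 * (N : ℝ≥0∞)⁻¹) (g := fun p : PertIndex → ℕ => p I)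
      (measurable_of_countable _) (by fun_prop),
    Measure.infinitePi_map_eval, lintegral_add_left (measurable_of_countable _),
    lintegral_mul_const _ (measurable_of_countable _), lintegral_descFactorial_poissonMeasure,
    lintegral_descFactorial_poissonMeasure, pow_one]

theorem lintegral_totalCollisions [NeZero N] (s : ℝ≥0) :
    ∫⁻ ω, totalCollisions ω ∂(pertLaw N s)
      = (∑' I, (pertWeight I : ℝ≥0∞)) * (s + s ^ 2 * (N : ℝ≥0∞)⁻¹) := by
  have hm : ∀ I, Measurable fun ω : PertDisorder N => (collisions I ω : ℝ≥0∞) := fun I =>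
    (measurable_of_countable (fun n : ℕ => (n : ℝ≥0∞))).comp (measurable_collisions I)
  simp only [totalCollisions]
  rw [lintegral_tsum fun I => ((hm I).const_mul _).aemeasurable]
  rw [← ENNReal.tsum_mul_right]
  refine tsum_congr fun I => ?_
  rw [lintegral_const_mul _ (hm I), lintegral_collisions]

theorem summable_collisions {ω : PertDisorder N} (hω : totalCollisions ω ≠ ⊤) :
    Summable fun I => (pertWeight I : ℝ) * collisions I ω := by
  have : ∑' I, ((pertWeight I * collisions I ω : ℝ≥0) : ℝ≥0∞) ≠ ⊤ := by
    simpa [totalCollisions] using hω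
  have := NNReal.summable_coe.2 (ENNReal.tsum_coe_ne_top_iff_summable.1 this)
  simpa using this

theorem toReal_totalCollisions (ω : PertDisorder N) :
    (totalCollisions ω).toReal = ∑' I, (pertWeight I : ℝ) * collisions I ω := by
  rw [totalCollisions, ENNReal.tsum_toReal_eq fun I => by finiteness]
  simp

theorem summable_pertWeight : Summable fun I => (pertWeight I : ℝ) :=
  NNReal.summable_coe.2 (ENNReal.tsum_coe_ne_top_iff_summable.1 tsum_pertWeight_ne_top)

/-! ### Lipschitz constant of the Poisson perturbation -/

/-- The contribution of the index `I` to the Poisson perturbation. -/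
noncomputable def pertTerm (I : PertIndex) (ω : PertDisorder N) (σ : Fin N → ℝ) : ℝ :=
  ∑ j ∈ Finset.range (ω.1 I), pertPoly I (σ (ω.2 (I, j)))

theorem pertTerm_nonneg (I : PertIndex) (ω : PertDisorder N) {σ : Fin N → ℝ} (hσ : σ ∈ cube N) :
    0 ≤ pertTerm I ω σ :=
  Finset.sum_nonneg fun _ _ => pertPoly_nonneg I (mem_cube_iff.1 hσ _)

theorem pertTerm_le (I : PertIndex) (ω : PertDisorder N) {σ : Fin N → ℝ} (hσ : σ ∈ cube N) :
    pertTerm I ω σ ≤ pertWeight I * collisions I ω := by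
  calc pertTerm I ω σ ≤ ∑ _j ∈ Finset.range (ω.1 I), (pertWeight I : ℝ) :=
        Finset.sum_le_sum fun j _ => pertPoly_le I (mem_cube_iff.1 hσ _)
    _ = pertWeight I * (ω.1 I : ℕ) := by simp [mul_comm]
    _ ≤ _ := by gcongr; exact le_collisions I ω

/-- Group the points by site and apply Cauchy–Schwarz over sites: the sum of the squared occupation
numbers is the number of colliding pairs. -/
theorem sum_abs_comp_le (m : ℕ) (u : ℕ → Fin N) (d : Fin N → ℝ) :
    ∑ j ∈ Finset.range m, |d (u j)|
      ≤ √(∑ a ∈ Finset.range m, ∑ b ∈ Finset.range m, if u a = u b then 1 else 0)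
        * √(∑ i, d i ^ 2) := by
  set n : Fin N → ℝ := fun i => ∑ a ∈ Finset.range m, if u a = i then 1 else 0 with hn
  have h1 : ∑ j ∈ Finset.range m, |d (u j)| = ∑ i, n i * |d i| := by
    simp only [hn, Finset.sum_mul]
    rw [Finset.sum_comm]
    simp
  have h2 : ∑ i, n i ^ 2
      = ∑ a ∈ Finset.range m, ∑ b ∈ Finset.range m, if u a = u b then (1 : ℝ) else 0 := by
    simp only [hn, sq, Finset.sum_mul_sum]
    rw [Finset.sum_comm]
    refine Finset.sum_congr rfl fun a _ => ?_
    rw [Finset.sum_comm]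
    refine Finset.sum_congr rfl fun b _ => ?_
    simp [eq_comm]
  rw [h1, ← h2]
  have := Real.sum_mul_le_sqrt_mul_sqrt Finset.univ n fun i => |d i|
  simpa using this

theorem abs_pertTerm_sub_le (I : PertIndex) (ω : PertDisorder N) {x y : Fin N → ℝ}
    (hx : x ∈ cube N) (hy : y ∈ cube N) :
    |pertTerm I ω x - pertTerm I ω y|
      ≤ pertWeight I * (√(collisions I ω) * √(∑ i, (x i - y i) ^ 2)) := by
  rw [pertTerm, pertTerm, ← Finset.sum_sub_distrib]
  calc _ ≤ ∑ j ∈ Finset.range (ω.1 I),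
        pertWeight I * |(fun i => x i - y i) (ω.2 (I, j))| :=
        (Finset.abs_sum_le_sum_abs _ _).trans (Finset.sum_le_sum fun j _ =>
          abs_pertPoly_sub_le I (mem_cube_iff.1 hx _) (mem_cube_iff.1 hy _))
    _ ≤ _ := by
        rw [← Finset.mul_sum]
        gcongr
        have := sum_abs_comp_le (ω.1 I) (fun j => ω.2 (I, j)) fun i => x i - y i
        simpa [collisions] using this

/-- AM–GM linearises the square root, so the Lipschitz constant becomes affine in the collision
counts, and summation over `I` and expectation are direct. The parameter `a` is chosen at the end.
-/
theorem sqrt_le_half_add {q a : ℝ} (hq : 0 ≤ q) (ha : 0 < a) : √q ≤ (q / a + a) / 2 := by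
  have h : 0 ≤ (√q - a) ^ 2 / a := by positivity
  have h2 : (√q - a) ^ 2 / a = q / a + a - 2 * √q := by
    rw [sub_sq, Real.sq_sqrt hq]; field_simp; ring
  linarith

theorem summable_pertTerm {lam : PertIndex → ℝ} (hlam : lam ∈ lambdaSet) {ω : PertDisorder N}
    (hω : totalCollisions ω ≠ ⊤) {x : Fin N → ℝ} (hx : x ∈ cube N) :
    Summable fun I => lam I * pertTerm I ω x := by
  refine Summable.of_nonneg_of_le (fun I => mul_nonneg (by linarith [(hlam I).1])
    (pertTerm_nonneg I ω hx)) (fun I => ?_) (summable_collisions hω)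
  calc lam I * pertTerm I ω x ≤ 1 * pertTerm I ω x :=
        mul_le_mul_of_nonneg_right (hlam I).2 (pertTerm_nonneg I ω hx)
    _ ≤ _ := by rw [one_mul]; exact pertTerm_le I ω hx

theorem euclideanLipschitz_poissonHamiltonian {lam : PertIndex → ℝ} (hlam : lam ∈ lambdaSet)
    {ω : PertDisorder N} (hω : totalCollisions ω ≠ ⊤) {a : ℝ} (ha : 0 < a) :
    EuclideanLipschitz (((totalCollisions ω).toReal / a + (∑' I, (pertWeight I : ℝ)) * a) / 2)
      (poissonHamiltonian lam ω) := by
  intro x hx y hy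
  have hsx := summable_pertTerm hlam hω hx
  have hsy := summable_pertTerm hlam hω hy
  have hsw : Summable fun I => ((pertWeight I : ℝ) * collisions I ω / a + pertWeight I * a) / 2 :=
    (((summable_collisions hω).div_const a).add (summable_pertWeight.mul_right a)).div_const 2
  have heq : poissonHamiltonian lam ω x - poissonHamiltonian lam ω y
      = ∑' I, (lam I * pertTerm I ω y - lam I * pertTerm I ω x) := by
    rw [hsy.tsum_sub hsx]
    simp only [poissonHamiltonian, pertTerm]
    ring
  have hB : ((totalCollisions ω).toReal / a + (∑' I, (pertWeight I : ℝ)) * a) / 2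
      = ∑' I, ((pertWeight I : ℝ) * collisions I ω / a + pertWeight I * a) / 2 := by
    rw [tsum_div_const, ((summable_collisions hω).div_const a).tsum_add
      (summable_pertWeight.mul_right a), tsum_div_const, tsum_mul_right, toReal_totalCollisions]
  rw [heq, hB, ← tsum_mul_right]
  refine Summable.tsum_le_tsum (fun I => ?_) (hsy.sub hsx) (hsw.mul_right _)
  have h1 := abs_pertTerm_sub_le I ω hx hy
  have h2 := sqrt_le_half_add (Nat.cast_nonneg (α := ℝ) (collisions I ω)) ha
  calc lam I * pertTerm I ω y - lam I * pertTerm I ω x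
      ≤ |lam I * (pertTerm I ω x - pertTerm I ω y)| := by
        rw [mul_sub, abs_sub_comm]
        exact le_abs_self _
    _ ≤ 1 * |pertTerm I ω x - pertTerm I ω y| := by
        rw [abs_mul, abs_of_nonneg (by linarith [(hlam I).1])]
        gcongr
        exact (hlam I).2
    _ ≤ pertWeight I * (((collisions I ω : ℝ) / a + a) / 2 * √(∑ i, (x i - y i) ^ 2)) := by
        rw [one_mul]
        refine h1.trans ?_
        gcongr
    _ = _ := by ring

/-- All weights are positive and collisions dominate the counts, so no Poisson point is present.
This serves the case `s = 0`. -/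
theorem poissonHamiltonian_eq_zero (lam : PertIndex → ℝ) {ω : PertDisorder N}
    (hω : totalCollisions ω = 0) : poissonHamiltonian lam ω = 0 := by
  have h : ∀ I, ω.1 I = 0 := fun I => by
    have h1 := (ENNReal.tsum_eq_zero.1 hω) I
    have h2 : (pertWeight I : ℝ≥0∞) ≠ 0 := by
      have := I.1.pos
      unfold pertWeight
      positivity
    have h3 : collisions I ω = 0 := by exact_mod_cast (mul_eq_zero.1 h1).resolve_left h2
    exact Nat.le_zero.1 (h3 ▸ le_collisions I ω)
  funext σ
  simp [poissonHamiltonian, h]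

/-! ### Measurability and integrability -/

/-- The nearest-point retraction onto the cube. -/
noncomputable def clamp (σ : Fin N → ℝ) : Fin N → ℝ := fun i => max (-1) (min 1 (σ i))

theorem continuous_clamp : Continuous (clamp : (Fin N → ℝ) → Fin N → ℝ) := by
  unfold clamp; fun_prop

theorem clamp_mem_cube (σ : Fin N → ℝ) : clamp σ ∈ cube N :=
  mem_cube_iff.2 fun _ => ⟨le_max_left _ _, max_le (by norm_num) (min_le_left _ _)⟩

theorem clamp_of_mem {σ : Fin N → ℝ} (hσ : σ ∈ cube N) : clamp σ = σ := by
  funext i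
  have := mem_cube_iff.1 hσ i
  rw [clamp, min_eq_right this.2, max_eq_right this.1]

/-- Composing with `clamp` and setting the function to zero off a measurable set of full measure
makes it continuous in `σ` for every `J` and measurable in `J` for every `σ`, hence jointly
measurable. -/
theorem exists_measurable_eq_on_cube {𝒥 : Type*} [MeasurableSpace 𝒥] {μ : Measure 𝒥}
    {H : 𝒥 → (Fin N → ℝ) → ℝ} (hm : ∀ σ ∈ cube N, Measurable fun J => H J σ)
    (hc : ∀ᵐ J ∂μ, ContinuousOn (H J) (cube N)) :
    ∃ F : 𝒥 → (Fin N → ℝ) → ℝ, Measurable (Function.uncurry F) ∧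
      ∀ᵐ J ∂μ, ∀ σ ∈ cube N, F J σ = H J σ := by
  obtain ⟨S, hS, hSm, hSc⟩ := hc.exists_measurable_mem
  have hu := stronglyMeasurable_uncurry_of_continuous_of_stronglyMeasurable
    (u := fun (σ : Fin N → ℝ) J => S.indicator (fun J => H J (clamp σ)) J)
    (fun J => by
      by_cases hJ : J ∈ S
      · simp only [Set.indicator_of_mem hJ]
        exact (hSc J hJ).comp_continuous continuous_clamp clamp_mem_cube
      · simp only [Set.indicator_of_notMem hJ]
        exact continuous_const)
    (fun σ => ((hm _ (clamp_mem_cube σ)).indicator hSm).stronglyMeasurable)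
  refine ⟨fun J σ => S.indicator (fun J => H J (clamp σ)) J,
    hu.measurable.comp measurable_swap, ?_⟩
  filter_upwards [hS] with J hJ σ hσ
  rw [Set.indicator_of_mem hJ, clamp_of_mem hσ]

theorem measurable_poissonHamiltonian (lam : PertIndex → ℝ) :
    Measurable fun p : PertDisorder N × (Fin N → ℝ) => poissonHamiltonian lam p.1 p.2 := by
  refine (Measurable.tsum fun I => Measurable.const_mul ?_ _).neg
  refine measurable_pert_of_forall I
    (f := fun m (q : (PertIndex × ℕ → Fin N) × (Fin N → ℝ)) =>
      ∑ j ∈ Finset.range m, pertPoly I (q.2 (q.1 (I, j)))) fun m => ?_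
  refine Finset.measurable_fun_sum _ fun j _ => ?_
  have h1 : Measurable (pertPoly I) := by unfold pertPoly; fun_prop
  have h2 : Measurable fun q : Fin N × (Fin N → ℝ) => q.2 q.1 :=
    measurable_from_prod_countable_right fun i => measurable_pi_apply i
  have h3 : Measurable fun q : (PertIndex × ℕ → Fin N) × (Fin N → ℝ) => (q.1 (I, j), q.2) := by
    fun_prop
  exact h1.comp (h2.comp h3)

/-- Almost surely the thermal mean is a polynomial in ratios of integrals of the jointly measurable
version `F`, which depend measurably on the disorder. -/
theorem aestronglyMeasurable_thermalMean {Ω : Type*} [MeasurableSpace Ω] {P : Measure Ω} {n : ℕ}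
    {G F : Ω → (Fin N → ℝ) → ℝ} (hF : Measurable (Function.uncurry F))
    (hG : ∀ᵐ ω ∂P, ContinuousOn (G ω) (cube N))
    (hFG : ∀ᵐ ω ∂P, ∀ σ ∈ cube N, F ω σ = G ω σ) (k : Fin n → ℕ) :
    AEStronglyMeasurable (fun ω => thermalMean (G ω) (multioverlap k)) P := by
  have hint : ∀ f : (Fin N → ℝ) → ℝ, Measurable f →
      Measurable fun ω => ∫ σ in cube N, f σ * Real.exp (F ω σ) := fun f hf =>
    (StronglyMeasurable.integral_prod_right
      (f := fun ω σ => f σ * Real.exp (F ω σ))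
      ((hf.comp measurable_snd).mul (Real.measurable_exp.comp hF)).stronglyMeasurable).measurable
  have hZ : Measurable fun ω => ∫ σ in cube N, Real.exp (F ω σ) := by
    simpa using hint (fun _ => 1) measurable_const
  have hm : Measurable fun ω => (N : ℝ)⁻¹ * ∑ i, ∏ l,
      (∫ σ in cube N, σ i ^ k l * Real.exp (F ω σ)) / ∫ σ in cube N, Real.exp (F ω σ) :=
    (Finset.measurable_fun_sum _ fun i _ => Finset.measurable_fun_prod _ fun l _ =>
      (hint (fun σ => σ i ^ k l) (by fun_prop)).div hZ).const_mul _
  refine ⟨_, hm.stronglyMeasurable, ?_⟩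
  filter_upwards [hG, hFG] with ω h1 h2
  have hcongr : ∀ f : (Fin N → ℝ) → ℝ, ∫ σ in cube N, f σ * Real.exp (G ω σ)
      = ∫ σ in cube N, f σ * Real.exp (F ω σ) := fun f =>
    setIntegral_congr_fun (measurableSet_cube N) fun σ hσ => by simp only [h2 σ hσ]
  have hcongr' : partitionFunction (G ω) = ∫ σ in cube N, Real.exp (F ω σ) :=
    setIntegral_congr_fun (measurableSet_cube N) fun σ hσ => by simp only [h2 σ hσ]
  rw [thermalMean_multioverlap h1]
  simp only [integral_gibbs, hcongr, hcongr']

instance (N : ℕ) [NeZero N] (s : ℝ≥0) : IsProbabilityMeasure (pertLaw N s) := by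
  unfold pertLaw; infer_instance

theorem continuousOn_regularisedHamiltonian {N : ℕ} {H : (Fin N → ℝ) → ℝ}
    (h : ContinuousOn H (cube N)) (ε : ℝ) : ContinuousOn (regularisedHamiltonian H ε) (cube N) := by
  have : Continuous (gaussHamiltonian ε : (Fin N → ℝ) → ℝ) := by
    unfold gaussHamiltonian; fun_prop
  exact h.add this.continuousOn

theorem continuousOn_perturbedHamiltonian {N : ℕ} {G : (Fin N → ℝ) → ℝ} (hG : ContinuousOn G (cube N))
    (ε : ℝ) {lam : PertIndex → ℝ} (hlam : lam ∈ lambdaSet) {ω : PertDisorder N}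
    (hω : totalCollisions ω ≠ ⊤) : ContinuousOn (perturbedHamiltonian G ε lam ω) (cube N) :=
  (continuousOn_regularisedHamiltonian hG ε).add
    (euclideanLipschitz_poissonHamiltonian hlam hω one_pos).continuousOn

theorem lintegral_totalCollisions_ne_top {N : ℕ} [NeZero N] (s : ℝ≥0) :
    ∫⁻ ω : PertDisorder N, totalCollisions ω ∂(pertLaw N s) ≠ ⊤ := by
  rw [lintegral_totalCollisions]
  have h : (N : ℝ≥0∞)⁻¹ ≠ ⊤ := by simp [NeZero.ne N]
  have := tsum_pertWeight_ne_top
  finiteness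

theorem ae_totalCollisions_ne_top {N : ℕ} [NeZero N] (s : ℝ≥0) :
    ∀ᵐ ω : PertDisorder N ∂(pertLaw N s), totalCollisions ω ≠ ⊤ :=
  (ae_lt_top measurable_totalCollisions (lintegral_totalCollisions_ne_top s)).mono
    fun _ h => h.ne

theorem integrable_totalCollisions {N : ℕ} [NeZero N] (s : ℝ≥0) :
    Integrable (fun ω : PertDisorder N => (totalCollisions ω).toReal) (pertLaw N s) :=
  integrable_toReal_of_lintegral_ne_top measurable_totalCollisions.aemeasurable
    (lintegral_totalCollisions_ne_top s)

theorem integral_totalCollisions {N : ℕ} [NeZero N] (s : ℝ≥0) :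
    ∫ ω : PertDisorder N, (totalCollisions ω).toReal ∂(pertLaw N s)
      = (∑' I, (pertWeight I : ℝ)) * (s + s ^ 2 / N) := by
  rw [integral_toReal measurable_totalCollisions.aemeasurable
    ((ae_totalCollisions_ne_top s).mono fun _ h => h.lt_top), lintegral_totalCollisions,
    ENNReal.toReal_mul, ENNReal.tsum_toReal_eq fun I => by finiteness]
  have h : (N : ℝ≥0∞)⁻¹ ≠ ⊤ := by simp [NeZero.ne N]
  rw [ENNReal.toReal_add (by finiteness) (by finiteness)]
  simp [div_eq_mul_inv]

theorem tsum_pertWeight_pos : 0 < ∑' I, (pertWeight I : ℝ) := by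
  refine summable_pertWeight.tsum_pos (fun I => by positivity)
    ⟨1, fun p => p, fun p => le_rfl⟩ ?_
  unfold pertWeight
  positivity

/-! ### Averaging over the disorder -/

section Model

variable {𝒥 : Type*} [MeasurableSpace 𝒥] {μ : Measure 𝒥} {N : ℕ}
  [NeZero N] {H : 𝒥 → (Fin N → ℝ) → ℝ} {n : ℕ}

/-- The change of the mean multioverlap caused by the Poisson perturbation. -/
noncomputable def overlapChange (H : 𝒥 → (Fin N → ℝ) → ℝ) (ε : ℝ) (lam : PertIndex → ℝ)
    (k : Fin n → ℕ) (ω : 𝒥 × PertDisorder N) : ℝ :=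
  |thermalMean (perturbedHamiltonian (H ω.1) ε lam ω.2) (multioverlap k)
    - thermalMean (regularisedHamiltonian (H ω.1) ε) (multioverlap k)|

theorem ae_good (h : ∀ᵐ J ∂μ, HasNegSemidefHessian (H J)) (s : ℝ≥0) :
    ∀ᵐ ω ∂(μ.prod (pertLaw N s)), HasNegSemidefHessian (H ω.1) ∧ totalCollisions ω.2 ≠ ⊤ :=
  (Measure.quasiMeasurePreserving_fst.ae h).and
    (Measure.quasiMeasurePreserving_snd.ae (ae_totalCollisions_ne_top s))

theorem integrable_overlapChange [IsProbabilityMeasure μ]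
    (hm : ∀ σ ∈ cube N, Measurable fun J => H J σ)
    (h : ∀ᵐ J ∂μ, HasNegSemidefHessian (H J)) (s : ℝ≥0) (ε : ℝ) {lam : PertIndex → ℝ}
    (hlam : lam ∈ lambdaSet) (k : Fin n → ℕ) :
    Integrable (overlapChange H ε lam k) (μ.prod (pertLaw N s)) := by
  obtain ⟨F, hF, hFH⟩ := exists_measurable_eq_on_cube hm (h.mono fun J hJ => hJ.continuousOn)
  have hFH' : ∀ᵐ ω ∂(μ.prod (pertLaw N s)), ∀ σ ∈ cube N, F ω.1 σ = H ω.1 σ :=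
    Measure.quasiMeasurePreserving_fst.ae hFH
  have hgood := ae_good h s
  have hgauss : Measurable (gaussHamiltonian ε : (Fin N → ℝ) → ℝ) := by
    unfold gaussHamiltonian; fun_prop
  have hF1 : Measurable (Function.uncurry fun (ω : 𝒥 × PertDisorder N) σ =>
      regularisedHamiltonian (F ω.1) ε σ) :=
    (hF.comp (f := fun q : (𝒥 × PertDisorder N) × (Fin N → ℝ) => (q.1.1, q.2))
      (by fun_prop)).add (hgauss.comp measurable_snd)
  have hF2 : Measurable (Function.uncurry fun (ω : 𝒥 × PertDisorder N) σ =>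
      perturbedHamiltonian (F ω.1) ε lam ω.2 σ) :=
    hF1.add ((measurable_poissonHamiltonian lam).comp
      (f := fun q : (𝒥 × PertDisorder N) × (Fin N → ℝ) => (q.1.2, q.2)) (by fun_prop))
  have m1 := aestronglyMeasurable_thermalMean
    (G := fun ω : 𝒥 × PertDisorder N => regularisedHamiltonian (H ω.1) ε) hF1
    (hgood.mono fun ω hω => continuousOn_regularisedHamiltonian hω.1.continuousOn ε)
    (hFH'.mono fun ω hω σ hσ => by simp only [regularisedHamiltonian, hω σ hσ]) k
  have m2 := aestronglyMeasurable_thermalMean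
    (G := fun ω : 𝒥 × PertDisorder N => perturbedHamiltonian (H ω.1) ε lam ω.2) hF2
    (hgood.mono fun ω hω => continuousOn_perturbedHamiltonian hω.1.continuousOn ε hlam hω.2)
    (hFH'.mono fun ω hω σ hσ => by simp only [perturbedHamiltonian, hω σ hσ]) k
  refine Integrable.of_bound (m2.sub m1).norm 2 ?_
  filter_upwards [hgood] with ω hω
  have h1 := abs_thermalMean_multioverlap_le_one
    (continuousOn_regularisedHamiltonian hω.1.continuousOn ε) k
  have h2 := abs_thermalMean_multioverlap_le_one
    (continuousOn_perturbedHamiltonian hω.1.continuousOn ε hlam hω.2) k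
  rw [overlapChange, Real.norm_eq_abs, abs_abs]
  rw [abs_le] at h1 h2 ⊢
  constructor <;> linarith

theorem integral_overlapChange_le_of_pos [IsProbabilityMeasure μ]
    (hm : ∀ σ ∈ cube N, Measurable fun J => H J σ)
    (h : ∀ᵐ J ∂μ, HasNegSemidefHessian (H J)) {s : ℝ≥0} (hs : 0 < s) {ε : ℝ} (hε : 0 < ε)
    {lam : PertIndex → ℝ} (hlam : lam ∈ lambdaSet) (k : Fin n → ℕ) :
    ∫ ω, overlapChange H ε lam k ω ∂(μ.prod (pertLaw N s))
      ≤ (4 * ∑ l, ((k l : ℝ) + 1)) * (∑' I, (pertWeight I : ℝ))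
        * (√(s + (s : ℝ) ^ 2 / N) / (ε * √N)) := by
  have hs' : (0 : ℝ) < s := hs
  have ha2 : (0 : ℝ) < s + (s : ℝ) ^ 2 / N := by positivity
  -- This value balances the two terms of the linearised Lipschitz constant: each has mean `c * a /
  -- 2`.
  set a := √(s + (s : ℝ) ^ 2 / N) with ha
  have ha0 : 0 < a := Real.sqrt_pos.2 ha2
  have hsq : a ^ 2 = s + (s : ℝ) ^ 2 / N := Real.sq_sqrt ha2.le
  set c := ∑' I, (pertWeight I : ℝ) with hc
  have hc0 : 0 < c := tsum_pertWeight_pos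
  set K := 4 * ∑ l, ((k l : ℝ) + 1) with hK
  set B : PertDisorder N → ℝ := fun ω => ((totalCollisions ω).toReal / a + c * a) / 2 with hB
  have hBi : Integrable B (pertLaw N s) :=
    (((integrable_totalCollisions s).div_const a).add (integrable_const _)).div_const 2
  have hBint : ∫ ω, B ω ∂(pertLaw N s) = c * a := by
    simp only [hB]
    rw [integral_div, integral_add ((integrable_totalCollisions s).div_const a)
      (integrable_const _), integral_div, integral_totalCollisions, ← hsq]
    simp only [integral_const, probReal_univ, one_smul, ← hc]
    field_simp
    ring
  calc ∫ ω, overlapChange H ε lam k ω ∂(μ.prod (pertLaw N s))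
      ≤ ∫ ω, K * (B ω.2 / (ε * √N)) ∂(μ.prod (pertLaw N s)) := by
        refine integral_mono_ae (integrable_overlapChange hm h s ε hlam k)
          (((hBi.comp_snd μ).div_const _).const_mul K) ?_
        filter_upwards [ae_good h s] with ω hω
        refine abs_thermalMean_multioverlap_sub_le (Nat.pos_of_neZero N) hε ?_
          (continuousOn_regularisedHamiltonian hω.1.continuousOn ε)
          (hω.1.stronglyMidConcave ε) (euclideanLipschitz_poissonHamiltonian hlam hω.2 ha0) k
        have : 0 ≤ (totalCollisions ω.2).toReal := ENNReal.toReal_nonneg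
        positivity
    _ = K * c * (a / (ε * √N)) := by
        rw [integral_const_mul, integral_div, integral_fun_snd, hBint]
        simp
        ring

theorem integral_overlapChange_zero (ε : ℝ) (lam : PertIndex → ℝ) (k : Fin n → ℕ) :
    ∫ ω, overlapChange H ε lam k ω ∂(μ.prod (pertLaw N 0)) = 0 := by
  have h0 : ∀ᵐ ω : PertDisorder N ∂(pertLaw N 0), totalCollisions ω = 0 := by
    refine (lintegral_eq_zero_iff measurable_totalCollisions).1 ?_
    rw [lintegral_totalCollisions]
    simp
  refine integral_eq_zero_of_ae ?_
  filter_upwards [Measure.quasiMeasurePreserving_snd.ae h0] with ω hω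
  have : perturbedHamiltonian (H ω.1) ε lam ω.2 = regularisedHamiltonian (H ω.1) ε := by
    funext σ
    simp [perturbedHamiltonian, regularisedHamiltonian, poissonHamiltonian_eq_zero lam hω]
  simp [overlapChange, this]

end Model

/-- The exponent is `1/2 - 1/3 = 1/6`: the square root contributes `(s / N) ^ (1/2)` and the
regularisation takes away `(s / N) ^ (1/3)`. -/
theorem sqrt_div_rpow_mul_sqrt {s N : ℝ} (hs : 0 < s) (hN : 0 < N) :
    √(s + s ^ 2 / N) / ((s / N) ^ (1 / 3 : ℝ) * √N)
      = (s / N) ^ (1 / 6 : ℝ) * √(1 + s / N) := by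
  have hx : 0 < s / N := by positivity
  have h1 : s + s ^ 2 / N = N * ((s / N) * (1 + s / N)) := by field_simp
  have h2 : √(s / N) = (s / N) ^ (1 / 6 : ℝ) * (s / N) ^ (1 / 3 : ℝ) := by
    rw [← Real.rpow_add hx, Real.sqrt_eq_rpow]; norm_num
  rw [h1, Real.sqrt_mul hN.le, Real.sqrt_mul hx.le, h2]
  have h3 : (s / N) ^ (1 / 3 : ℝ) ≠ 0 := (Real.rpow_pos_of_pos hx _).ne'
  have h4 : √N ≠ 0 := (Real.sqrt_pos.2 hN).ne'
  field_simp

end LogConcaveGibbs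


theorem mainTheorem7 (n : ℕ) (hn : 1 ≤ n) (k : Fin n → ℕ) :
    ∃ C : ℝ, 0 < C ∧
      ∀ (𝒥 : ℕ+ → Type*) [∀ N, MeasurableSpace (𝒥 N)]
        (μ : (N : ℕ+) → Measure (𝒥 N)) [∀ N, IsProbabilityMeasure (μ N)]
        (H : (N : ℕ+) → 𝒥 N → (Fin N → ℝ) → ℝ) (s : ℕ+ → ℝ≥0),
        (∀ N : ℕ+, ∀ σ ∈ cube N, Measurable fun J => H N J σ) →
        (∀ N, ∀ᵐ J ∂(μ N), HasNegSemidefHessian (H N J)) →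
        (∀ N, SpinExchangeable (μ N) (H N)) →
        Tendsto s atTop atTop →
        Tendsto (fun N : ℕ+ => (s N : ℝ) / (N : ℕ)) atTop (𝓝 0) →
        Tendsto (fun N : ℕ+ =>
          (perturbedVariance (μ N) (H N) (epsilon s N) (s N)) ^ (1 / 2 : ℝ) / (s N : ℝ≥0∞))
          atTop (𝓝 0) →
        ∃ δ : ℕ+ → ℝ, Tendsto δ atTop (𝓝 0) ∧
          ∀ (N : ℕ+), ∀ lam ∈ lambdaSet,
            Integrable (fun ω : 𝒥 N × PertDisorder N =>
              |thermalMean (perturbedHamiltonian (H N ω.1) (epsilon s N) lam ω.2) (multioverlap k)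
                - thermalMean (regularisedHamiltonian (H N ω.1) (epsilon s N)) (multioverlap k)|)
              ((μ N).prod (pertLaw N (s N))) ∧
            ∫ ω : 𝒥 N × PertDisorder N,
              |thermalMean (perturbedHamiltonian (H N ω.1) (epsilon s N) lam ω.2) (multioverlap k)
                - thermalMean (regularisedHamiltonian (H N ω.1) (epsilon s N)) (multioverlap k)|
              ∂((μ N).prod (pertLaw N (s N)))
              ≤ C * ((s N : ℝ) / (N : ℕ)) ^ (1 / 6 : ℝ) * (1 + δ N) := by
  have hK : 0 < 4 * ∑ l, ((k l : ℝ) + 1) := by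
    have : Nonempty (Fin n) := ⟨⟨0, hn⟩⟩
    have := Finset.sum_pos (s := (Finset.univ : Finset (Fin n))) (f := fun l => (k l : ℝ) + 1)
      (fun l _ => by positivity) Finset.univ_nonempty
    positivity
  refine ⟨(4 * ∑ l, ((k l : ℝ) + 1)) * ∑' I, (pertWeight I : ℝ),
    mul_pos hK tsum_pertWeight_pos, ?_⟩
  intro 𝒥 _ μ _ H s hm hH _ _ hsN _
  refine ⟨fun N => √(1 + (s N : ℝ) / (N : ℕ)) - 1, ?_, fun N lam hlam =>
    ⟨integrable_overlapChange (hm N) (hH N) (s N) _ hlam k, ?_⟩⟩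
  · have := ((hsN.const_add 1).sqrt).sub_const 1
    simpa using this
  have hN : (0 : ℝ) < (N : ℕ) := by exact_mod_cast N.pos
  rw [add_sub_cancel]
  -- When `s N = 0` the regularisation vanishes too and strong concavity is lost, but then the
  -- perturbation is almost surely zero.
  rcases eq_zero_or_pos (s N) with h0 | hpos
  · have h := integral_overlapChange_zero (μ := μ N) (H := H N) (epsilon s N) lam k
    rw [← h0] at h
    refine (le_of_eq h).trans ?_
    have := hK.le
    have := tsum_pertWeight_pos.le
    positivity
  · have hs : (0 : ℝ) < s N := hpos
    have hε : 0 < epsilon s N := Real.rpow_pos_of_pos (by positivity) _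
    refine (integral_overlapChange_le_of_pos (hm N) (hH N) hpos hε hlam k).trans_eq ?_
    rw [epsilon, sqrt_div_rpow_mul_sqrt hs hN, mul_assoc _ (_ ^ _)]
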